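/- Let $\mathbf X$ be a countable structure in a countable first-order language, and assume that: (a) $\mathbf X$ is $\omega$-categorical: up to isomorphism it is the only countable model of its first-order theory; (b) $\mathbf X$ is homogeneous: every isomorphism between finite substructures of $\mathbf X$ extends to an automorphism of $\mathbf X$; (c) $\mathbf X$ admits weak elimination of imaginaries: for every $m \ge 0$ and every imaginary $\alpha$ (an equivalence class $\alpha \subseteq \mathbf X^m$ of an equivalence relation on a subset of $\mathbf X^m$, both definable without parameters) there are $n \ge 0$ and a formula $\phi(\bar x,\bar y)$ without parameters such that the set of all $\bar c\in \mathbf X^n$ with $\alpha=\{\bar x\in\mathbf X^m : \phi(\bar x,\bar c)\}$ is finite and non-empty. Let $G=\mathrm{Aut}(\mathbf X)$ with the topology of pointwise convergence, $\mathbf X$ being discrete. A representation of $G$ is a strongly continuous homomorphism into the unitary group of a complex Hilbert space; it is irreducible if the space is non-zero and has no closed invariant subspaces other than $0$ and the whole space. For a finite substructure $A$ (possibly empty), a representation of the finite group $\mathrm{Aut}(A)$ is a homomorphism into the unitary group of a complex Hilbert space, and irreducibility is defined in the same way. Let $G_A=\{g\in G: g(A)=A\}$. The substructure $A$ is algebraically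 closed if every point of $\mathbf X$ whose orbit under the pointwise stabilizer of $A$ is finite lies in $A$. A representation $\sigma$ of $\mathrm{Aut}(A)$ on $K$ is regarded as a representation of $G_A$ through the restriction homomorphism $G_A\to\mathrm{Aut}(A)$, and $\mathrm{Ind}_{G_A}^G(\sigma)$ is the action $(g\cdot f)(x)=f(g^{-1}x)$ of $G$ on the Hilbert space of all functions $f\colon G\to K$ with $f(gh)=\sigma(h^{-1})f(g)$ for $g \in G$, $h\in G_A$, and $\|f\|^2=\sum_{t\in T}\|f(t)\|^2<\infty$, where $T$ is a system of representatives of the left cosets of $G_A$ in $G$. Then: 1. For every finite algebraically closed substructure $A\subseteq\mathbf X$ and every irreducible representation $\sigma$ of $\mathrm{Aut}(A)$, $\mathrm{Ind}_{G_A}^G(\sigma)$ is a (strongly continuous, unitary) irreducible representation of $G$. 2. Every irreducible representation of $G$ is unitarily equivalent to $\mathrm{Ind}_{G_A}^G(\sigma)$ for some finite algebraically closed substructure $A\subseteq\mathbf X$ and some irreducible representation $\sigma$ of $\mathrm{Aut}(A)$. 3. There are no repetitions, apart from those given by isomorphisms of substructures: for finite algebraically closed substructures $A,B\subseteq\mathbf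 X$ and irreducible representations $\sigma$ of $\mathrm{Aut}(A)$ and $\tau$ of $\mathrm{Aut}(B)$, the representations $\mathrm{Ind}_{G_A}^G(\sigma)$ and $\mathrm{Ind}_{G_B}^G(\tau)$ are unitarily equivalent if and only if there is an isomorphism $f\colon A\to B$ such that $\sigma$ is unitarily equivalent to $g\mapsto\tau(fgf^{-1})$. In particular, $\mathrm{Ind}_{G_A}^G(\sigma)\cong\mathrm{Ind}_{G_A}^G(\tau)$ if and only if $\sigma\cong\tau$. -/

import Mathlib

open FirstOrder

universe u v w h

namespace OmegaCat

/-! ### Unitary representations -/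

section Representations

/-- A homomorphism from `G` to the unitary group of `H`. -/
abbrev UnitaryRep (G : Type*) [Group G] (H : Type*) [NormedAddCommGroup H]
    [InnerProductSpace ℂ H] : Type _ :=
  G →* (H ≃ₗᵢ[ℂ] H)

theorem unitary_mul_apply {H : Type*} [NormedAddCommGroup H] [InnerProductSpace ℂ H]
    (U V : H ≃ₗᵢ[ℂ] H) (ξ : H) : (U * V) ξ = U (V ξ) := rfl

/-- Strong continuity: all orbit maps `g ↦ π g ξ` are continuous. -/
def StronglyContinuous {G : Type*} [Group G] [TopologicalSpace G] {H : Type*}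
    [NormedAddCommGroup H] [InnerProductSpace ℂ H] (π : UnitaryRep G H) : Prop :=
  ∀ ξ : H, Continuous fun g : G => π g ξ

/-- Irreducibility: the space is nonzero and its only closed invariant subspaces are the
trivial ones. -/
def IsIrreducibleRep {G : Type*} [Group G] {H : Type*} [NormedAddCommGroup H]
    [InnerProductSpace ℂ H] (π : UnitaryRep G H) : Prop :=
  Nontrivial H ∧ ∀ W : Submodule ℂ H, IsClosed (W : Set H) →
    (∀ g : G, ∀ ξ ∈ W, π g ξ ∈ W) → W = ⊥ ∨ W = ⊤

/-- Unitary equivalence of representations. -/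
def UnitarilyEquivalent {G : Type*} [Group G] {H₁ H₂ : Type*}
    [NormedAddCommGroup H₁] [InnerProductSpace ℂ H₁]
    [NormedAddCommGroup H₂] [InnerProductSpace ℂ H₂]
    (π₁ : UnitaryRep G H₁) (π₂ : UnitaryRep G H₂) : Prop :=
  ∃ U : H₁ ≃ₗᵢ[ℂ] H₂, ∀ (g : G) (ξ : H₁), U (π₁ g ξ) = π₂ g (U ξ)

end Representations

/-! ### Induced representations -/

section Induced

variable {G : Type*} [Group G] {K : Type*} [NormedAddCommGroup K] [InnerProductSpace ℂ K]

/-- The functions `f : G → K` with `f (g h) = σ (h⁻¹) (f g)` for `h ∈ H`, and with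
`∑ ‖f t‖² < ∞`, `t` running over a system of representatives of the left cosets of `H`. -/
def indSubmodule (H : Subgroup G) (σ : UnitaryRep H K) : Submodule ℂ (G → K) where
  carrier := {f | (∀ (g : G) (h : H), f (g * h) = σ h⁻¹ (f g)) ∧
    Summable fun q : G ⧸ H => ‖f q.out‖ ^ 2}
  add_mem' := by
    rintro a b ⟨ha, ha'⟩ ⟨hb, hb'⟩
    refine ⟨fun g h => by simp [ha g h, hb g h], ?_⟩
    refine Summable.of_nonneg_of_le (fun _ => by positivity) (fun q => ?_)
      ((ha'.mul_left 2).add (hb'.mul_left 2))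
    have h1 := norm_add_le (a q.out) (b q.out)
    have h2 := norm_nonneg (a q.out + b q.out)
    simp only [Pi.add_apply]
    nlinarith [sq_nonneg (‖a q.out‖ - ‖b q.out‖)]
  zero_mem' := ⟨fun g h => by simp, by simp⟩
  smul_mem' := by
    rintro c a ⟨ha, ha'⟩
    refine ⟨fun g h => by simp [ha g h], ?_⟩
    simpa [norm_smul, mul_pow] using ha'.mul_left (‖c‖ ^ 2)

/-- The space of the induced representation. -/
def IndSpace (H : Subgroup G) (σ : UnitaryRep H K) : Type _ := ↥(indSubmodule H σ)

variable {H : Subgroup G} {σ : UnitaryRep H K}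

noncomputable instance : AddCommGroup (IndSpace H σ) :=
  inferInstanceAs (AddCommGroup ↥(indSubmodule H σ))

noncomputable instance : Module ℂ (IndSpace H σ) :=
  inferInstanceAs (Module ℂ ↥(indSubmodule H σ))

instance : CoeFun (IndSpace H σ) (fun _ => G → K) := ⟨fun f => f.1⟩

theorem IndSpace.ext {f₁ f₂ : IndSpace H σ} (h : ∀ g, f₁ g = f₂ g) : f₁ = f₂ :=
  Subtype.ext (funext h)

theorem IndSpace.norm_mul (f : IndSpace H σ) (g : G) (h : H) : ‖f (g * h)‖ = ‖f g‖ := by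
  rw [f.2.1 g h, LinearIsometryEquiv.norm_map]

/-- The norm `‖f g‖` depends only on the left coset of `g`. -/
theorem IndSpace.norm_out (f : IndSpace H σ) (g : G) :
    ‖f (Quotient.out (g : G ⧸ H))‖ = ‖f g‖ := by
  obtain ⟨h, hh⟩ := QuotientGroup.mk_out_eq_mul H g
  rw [hh, f.norm_mul]

theorem memlp_two_iff {ι E : Type*} [NormedAddCommGroup E] (φ : ι → E) :
    Memℓp φ 2 ↔ Summable fun i => ‖φ i‖ ^ 2 := by
  rw [memℓp_gen_iff (by norm_num)]
  norm_num

/-- Restriction to a system of coset representatives identifies the space with `ℓ²(G/H, K)`. -/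
noncomputable def IndSpace.toLp (H : Subgroup G) (σ : UnitaryRep H K) :
    IndSpace H σ ≃ₗ[ℂ] lp (fun _ : G ⧸ H => K) 2 where
  toFun f := ⟨fun q => f q.out, (memlp_two_iff _).2 f.2.2⟩
  map_add' _ _ := rfl
  map_smul' _ _ := rfl
  invFun φ := ⟨fun g => σ ⟨g⁻¹ * Quotient.out (g : G ⧸ H), by
      rw [← QuotientGroup.eq, QuotientGroup.out_eq']⟩ (φ (g : G ⧸ H)), by
    constructor
    · intro g h
      have hq : ((g * h : G) : G ⧸ H) = (g : G ⧸ H) := QuotientGroup.mk_mul_of_mem g h.2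
      have key : ∀ (q : G ⧸ H) (hq : q = (g : G ⧸ H)) (h1 : (g * h : G)⁻¹ * q.out ∈ H)
          (h2 : g⁻¹ * Quotient.out (g : G ⧸ H) ∈ H),
          σ ⟨(g * h : G)⁻¹ * q.out, h1⟩ (φ q) =
            σ h⁻¹ (σ ⟨g⁻¹ * Quotient.out (g : G ⧸ H), h2⟩ (φ (g : G ⧸ H))) := by
        rintro q rfl h1 h2
        rw [← unitary_mul_apply, ← map_mul]
        congr 2
        apply Subtype.ext
        simp [mul_assoc]
      exact key _ hq _ _
    · have := (memlp_two_iff _).1 φ.2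
      refine this.congr fun q => ?_
      simp⟩
  left_inv f := by
    apply IndSpace.ext
    intro g
    change σ _ (f (Quotient.out (g : G ⧸ H))) = f g
    have hm : g⁻¹ * Quotient.out (g : G ⧸ H) ∈ H := by
      rw [← QuotientGroup.eq, QuotientGroup.out_eq']
    have h1 : (Quotient.out (g : G ⧸ H)) = g * (⟨_, hm⟩ : H) := by simp
    have h2 := f.2.1 g ⟨_, hm⟩
    rw [← h1] at h2
    rw [h2, ← unitary_mul_apply, ← map_mul, mul_inv_cancel, map_one]
    rfl
  right_inv φ := by
    apply Subtype.ext
    funext q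
    have key : ∀ (q' : G ⧸ H) (hq : q' = q) (h1 : (Quotient.out q)⁻¹ * Quotient.out q' ∈ H),
        σ ⟨(Quotient.out q)⁻¹ * Quotient.out q', h1⟩ (φ q') = φ q := by
      rintro q' rfl h1
      have : (⟨(Quotient.out q')⁻¹ * Quotient.out q', h1⟩ : H) = 1 := by
        apply Subtype.ext; simp
      rw [this, map_one]; rfl
    exact key _ (QuotientGroup.out_eq' q) _

/-- The norm is `(∑ ‖f t‖²)^(1/2)`, see `IndSpace.norm_sq_eq`. -/
noncomputable instance : NormedAddCommGroup (IndSpace H σ) :=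
  NormedAddCommGroup.induced (IndSpace H σ) (lp (fun _ : G ⧸ H => K) 2)
    (IndSpace.toLp H σ) (IndSpace.toLp H σ).injective

noncomputable instance : InnerProductSpace ℂ (IndSpace H σ) where
  toNormedSpace := NormedSpace.induced ℂ (IndSpace H σ) (lp (fun _ : G ⧸ H => K) 2)
    (IndSpace.toLp H σ)
  inner f₁ f₂ := ∑' q : G ⧸ H, inner ℂ (f₁ q.out) (f₂ q.out)
  norm_sq_eq_re_inner f :=
    (InnerProductSpace.norm_sq_eq_re_inner (𝕜 := ℂ) (IndSpace.toLp H σ f)).trans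
      (congrArg _ (lp.inner_eq_tsum _ _))
  conj_inner_symm f₁ f₂ := by
    have := InnerProductSpace.conj_inner_symm (𝕜 := ℂ) (IndSpace.toLp H σ f₁)
      (IndSpace.toLp H σ f₂)
    rwa [lp.inner_eq_tsum, lp.inner_eq_tsum] at this
  add_left f₁ f₂ f₃ := by
    have := InnerProductSpace.add_left (𝕜 := ℂ) (IndSpace.toLp H σ f₁)
      (IndSpace.toLp H σ f₂) (IndSpace.toLp H σ f₃)
    rwa [lp.inner_eq_tsum, lp.inner_eq_tsum, lp.inner_eq_tsum] at this
  smul_left f₁ f₂ c := by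
    have := InnerProductSpace.smul_left (𝕜 := ℂ) (IndSpace.toLp H σ f₁)
      (IndSpace.toLp H σ f₂) c
    rwa [lp.inner_eq_tsum, lp.inner_eq_tsum] at this

theorem IndSpace.norm_sq_eq (f : IndSpace H σ) : ‖f‖ ^ 2 = ∑' q : G ⧸ H, ‖f q.out‖ ^ 2 := by
  have h := lp.norm_rpow_eq_tsum (p := 2) (by norm_num) (IndSpace.toLp H σ f)
  norm_num at h
  exact h

/-- The space of the induced representation is a Hilbert space. -/
instance [CompleteSpace K] : CompleteSpace (IndSpace H σ) := by
  let e : IndSpace H σ ≃ₗᵢ[ℂ] lp (fun _ : G ⧸ H => K) 2 :=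
    { IndSpace.toLp H σ with norm_map' := fun _ => rfl }
  exact (completeSpace_congr (e := e.toEquiv) e.isometry.isUniformEmbedding).2 inferInstance

theorem IndSpace.translate_mem (g : G) (f : IndSpace H σ) :
    (fun x => f (g⁻¹ * x)) ∈ indSubmodule H σ := by
  refine ⟨fun x h => ?_, ?_⟩
  · change f.1 (g⁻¹ * (x * h)) = σ h⁻¹ (f.1 (g⁻¹ * x))
    rw [← mul_assoc]
    exact f.2.1 _ _
  · have h := (Equiv.summable_iff (MulAction.toPerm (g⁻¹ : G) : Equiv.Perm (G ⧸ H))).2 f.2.2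
    refine h.congr fun q => ?_
    have : (g⁻¹ • q : G ⧸ H) = ((g⁻¹ * q.out : G) : G ⧸ H) := by
      conv_lhs => rw [← QuotientGroup.out_eq' q]
      rfl
    simp only [Function.comp_apply, MulAction.toPerm_apply]
    rw [this, f.norm_out]

/-- Left translation by `g` on the space of the induced representation. -/
noncomputable def indMap (H : Subgroup G) (σ : UnitaryRep H K) (g : G) :
    IndSpace H σ ≃ₗᵢ[ℂ] IndSpace H σ where
  toFun f := ⟨fun x => f (g⁻¹ * x), IndSpace.translate_mem g f⟩
  map_add' _ _ := rfl
  map_smul' _ _ := rfl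
  invFun f := ⟨fun x => f (g * x), by simpa using IndSpace.translate_mem g⁻¹ f⟩
  left_inv f := IndSpace.ext fun x => congrArg f.1 (inv_mul_cancel_left g x)
  right_inv f := IndSpace.ext fun x => congrArg f.1 (mul_inv_cancel_left g x)
  norm_map' f := by
    rw [← sq_eq_sq₀ (norm_nonneg _) (norm_nonneg _), IndSpace.norm_sq_eq, IndSpace.norm_sq_eq]
    rw [← Equiv.tsum_eq (MulAction.toPerm (g⁻¹ : G) : Equiv.Perm (G ⧸ H))
      (fun q => ‖f q.out‖ ^ 2)]
    refine tsum_congr fun q => ?_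
    have : (g⁻¹ • q : G ⧸ H) = ((g⁻¹ * q.out : G) : G ⧸ H) := by
      conv_lhs => rw [← QuotientGroup.out_eq' q]
      rfl
    simp only [MulAction.toPerm_apply]
    rw [this, f.norm_out]
    rfl

/-- The induced representation `Ind_H^G(σ)`, given by `(g · f)(x) = f (g⁻¹ x)`. -/
noncomputable def ind (H : Subgroup G) (σ : UnitaryRep H K) : UnitaryRep G (IndSpace H σ) where
  toFun g := indMap H σ g
  map_one' := by
    ext f
    refine IndSpace.ext fun x => ?_
    change f (1⁻¹ * x) = f x
    rw [inv_one, one_mul]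
  map_mul' g₁ g₂ := by
    ext f
    refine IndSpace.ext fun x => ?_
    change f ((g₁ * g₂)⁻¹ * x) = f (g₂⁻¹ * (g₁⁻¹ * x))
    rw [mul_inv_rev, mul_assoc]

end Induced

/-! ### Automorphism groups of structures -/

section Automorphisms



variable {L : FirstOrder.Language.{u, v}} {X : Type w} [L.Structure X]

/-- The automorphism group of a structure, under composition. -/
instance autGroup : Group (X ≃[L] X) where
  mul g h := g.comp h
  one := FirstOrder.Language.Equiv.refl L X
  inv g := g.symm
  mul_assoc _ _ _ := rfl
  one_mul _ := rfl
  mul_one _ := rfl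
  inv_mul_cancel g := FirstOrder.Language.Equiv.ext fun x => g.symm_apply_apply x

/-- The topology of pointwise convergence on the automorphism group, `X` being discrete. -/
instance autTopology : TopologicalSpace (X ≃[L] X) :=
  TopologicalSpace.induced (fun g : X ≃[L] X => (g : X → X))
    (@Pi.topologicalSpace X (fun _ => X) (fun _ => ⊥))

/-- The setwise stabilizer `G_A` of a substructure `A`. -/
def setStabilizer (A : L.Substructure X) : Subgroup (X ≃[L] X) where
  carrier := {g | (g : X → X) '' (A : Set X) = A}
  one_mem' := Set.image_id (A : Set X)
  mul_mem' := by
    intro g h hg hh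
    change (fun x => g (h x)) '' (A : Set X) = A
    rw [← Set.image_image (fun x => g x) (fun x => h x)]
    exact (congrArg _ hh).trans hg
  inv_mem' := by
    intro g hg
    have hg' : (g : X → X) '' (A : Set X) = A := hg
    change (g.symm : X → X) '' (A : Set X) = A
    conv_lhs => rw [← hg']
    rw [Set.image_image]
    simp

theorem setStabilizer_apply_mem {A : L.Substructure X} (g : setStabilizer A) (a : A) :
    (g : X ≃[L] X) a ∈ A := by
  have hg : ((g : X ≃[L] X) : X → X) '' (A : Set X) = A := g.2
  have : (g : X ≃[L] X) a ∈ (A : Set X) := hg ▸ Set.mem_image_of_mem _ a.2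
  exact this

/-- The restriction homomorphism `G_A → Aut(A)`. -/
def restrictHom (A : L.Substructure X) : setStabilizer A →* (A ≃[L] A) where
  toFun g :=
    { toFun := fun a => ⟨(g : X ≃[L] X) a, setStabilizer_apply_mem g a⟩
      invFun := fun a => ⟨((g⁻¹ : setStabilizer A) : X ≃[L] X) a, setStabilizer_apply_mem g⁻¹ a⟩
      left_inv := fun a => Subtype.ext ((g : X ≃[L] X).symm_apply_apply a)
      right_inv := fun a => Subtype.ext ((g : X ≃[L] X).apply_symm_apply a)
      map_fun' := fun f x => Subtype.ext ((g : X ≃[L] X).map_fun f (fun i => (x i : X)))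
      map_rel' := fun r x => (g : X ≃[L] X).map_rel r (fun i => (x i : X)) }
  map_one' := rfl
  map_mul' _ _ := rfl

/-- `Ind_{G_A}^G(σ)`, where a representation `σ` of `Aut(A)` is regarded as a representation of
`G_A` through the restriction homomorphism `G_A → Aut(A)`. -/
noncomputable abbrev indAut (A : L.Substructure X) {K : Type*} [NormedAddCommGroup K]
    [InnerProductSpace ℂ K] (σ : UnitaryRep (A ≃[L] A) K) :
    UnitaryRep (X ≃[L] X) (IndSpace (setStabilizer A) (σ.comp (restrictHom A))) :=
  ind (setStabilizer A) (σ.comp (restrictHom A))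

/-- The isomorphism of automorphism groups `g ↦ f g f⁻¹` given by an isomorphism `f`. -/
def autCongr {A B : Type*} [L.Structure A] [L.Structure B] (f : A ≃[L] B) :
    (A ≃[L] A) ≃* (B ≃[L] B) where
  toFun g := (f.comp g).comp f.symm
  invFun g := (f.symm.comp g).comp f
  left_inv g := FirstOrder.Language.Equiv.ext fun x => by simp
  right_inv g := FirstOrder.Language.Equiv.ext fun x => by simp
  map_mul' g h := FirstOrder.Language.Equiv.ext fun x => by
    change f (g (h (f.symm x))) = f (g (f.symm (f (h (f.symm x)))))
    simp

/-- `X` is algebraically closed over `A`: every point whose orbit under the pointwise stabilizer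
of `A` is finite (i.e. every point algebraic over `A`) belongs to `A`. -/
def AlgebraicallyClosed (A : L.Substructure X) : Prop :=
  ∀ b : X, {c : X | ∃ g : X ≃[L] X, (∀ a ∈ A, g a = a) ∧ g b = c}.Finite → b ∈ A

variable (L X)

/-- `X` is countable, and it is up to isomorphism the only countable model of its first-order
theory. -/
def OmegaCategorical : Prop :=
  Countable X ∧ ∀ (N : Type w) [L.Structure N], Countable N → L.ElementarilyEquivalent X N →
    Nonempty (X ≃[L] N)

/-- Every isomorphism between finite substructures extends to an automorphism. -/
def Homogeneous : Prop :=
  ∀ (A B : L.Substructure X), Finite A → Finite B → ∀ f : A ≃[L] B,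
    ∃ g : X ≃[L] X, ∀ a : A, g a = f a

variable {X}

/-- `α` is an imaginary element: a class of an equivalence relation `r` on a set `D` of
`m`-tuples, `D` and `r` being definable without parameters. -/
def IsImaginary {m : ℕ} (α : Set (Fin m → X)) : Prop :=
  ∃ (D : Set (Fin m → X)) (r : (Fin m → X) → (Fin m → X) → Prop),
    (∅ : Set X).Definable L D ∧
    (∅ : Set X).Definable L
      {z : Fin m ⊕ Fin m → X | r (fun i => z (Sum.inl i)) (fun i => z (Sum.inr i))} ∧
    (∀ x y, r x y → x ∈ D ∧ y ∈ D) ∧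
    (∀ x ∈ D, r x x) ∧ (∀ x y, r x y → r y x) ∧ (∀ x y z, r x y → r y z → r x z) ∧
    ∃ a ∈ D, α = {x | r a x}

variable (X)

/-- For every imaginary `α` there is a formula `φ(x, y)` without parameters such that the set of
the tuples `c` with `α = {x | φ(x, c)}` is finite and non-empty. (The tuple `c` may be empty.) -/
def WeakElimination : Prop :=
  ∀ (m : ℕ) (α : Set (Fin m → X)), IsImaginary L α →
    ∃ (n : ℕ) (φ : L.Formula (Fin m ⊕ Fin n)),
      {c : Fin n → X | α = {x | φ.Realize (Sum.elim x c)}}.Finite ∧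
      {c : Fin n → X | α = {x | φ.Realize (Sum.elim x c)}}.Nonempty

end Automorphisms

end OmegaCat

open OmegaCat

namespace OmegaCat

/-! ### Types in an `ω`-categorical structure -/

section Types

open FirstOrder.Language

variable {L : FirstOrder.Language.{u, v}} {X : Type w} [L.Structure X]

/-! Write G_(A) for the pointwise stabilizer of A and H^A for the vectors of H fixed by it. The
model theory supplies three facts. By Ryll-Nardzewski and homogeneity, G has finitely many orbits on
tuples of each finite length (`exists_finite_orbit_representatives`). Every finite set lies in a
finite algebraically closed substructure (`exists_algebraicallyClosed`). Weak elimination of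
imaginaries gives each open subgroup W a support D (`exists_finite_support`): G_(D) ≤ W, and D ⊆ A
for every algebraically closed A such that W ∩ G_(A) has finite index in G_(A). For stabilizers of
vectors, with A and B finite and algebraically closed, this says that a vector with a finite
G_(A)-orbit lies in H^A and that H^A ∩ H^B = H^(A ∩ B).

The analytic core is `starProjection_mem_fixedVectors`: the projection onto H^B maps H^A into H^A. A
vector ξ in H^A has only finitely many matrix coefficients ⟨ξ, gξ⟩, hence inner products of weak
limits of its orbit also take finitely many values, and monotone norm arguments terminate after
finitely many steps.

Given an irreducible π, continuity makes some H^A nonzero; take A of least size. If gA ≠ A, the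
projection of H^A to H^(gA) lies in H^(A ∩ gA) = 0, so H^A is orthogonal to its translate by g.
Hence π is induced from the action of G_A on H^A (`equivalent_ind`), which factors through Aut(A).

For the remaining claims, a square-summable function fixed by G_(A) lives on cosets xG_B with a
finite G_(A)-orbit, and then xB ⊆ A because A is algebraically closed (`apply_mem_of_finite_orbit`).
For B = A the fixed vectors of the induced representation are just the copy of K at the identity
coset, which gives irreducibility. For two equivalent induced representations, inclusions both ways
and a count give xB = A, and evaluation at x recovers the equivalence of σ and τ. -/

theorem countable_formula [Countable L.Symbols] (ι : Type*) [Countable ι] :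
    Countable (L.Formula ι) := by
  have h := BoundedFormula.card_le (L := L) (α := ι)
  have hL : L.card ≤ Cardinal.aleph0 := Cardinal.mk_le_aleph0
  have h2 : Cardinal.mk (Σ n, L.BoundedFormula ι n) ≤ Cardinal.aleph0 :=
    h.trans (max_le le_rfl (Cardinal.add_le_aleph0.2
      ⟨Cardinal.lift_le_aleph0.2 Cardinal.mk_le_aleph0, Cardinal.lift_le_aleph0.2 hL⟩))
  have : Countable (Σ n, L.BoundedFormula ι n) := Cardinal.mk_le_aleph0_iff.1 h2
  exact Function.Injective.countable (f := fun φ : L.Formula ι => (⟨0, φ⟩ : Σ n, L.BoundedFormula ι n))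
    fun a b hab => by simpa using hab

theorem exists_countable_elementarySubstructure [Countable L.Symbols] {M : Type w} [L.Structure M]
    (s : Set M) (hs : s.Countable) : ∃ S : L.ElementarySubstructure M, s ⊆ S ∧ Countable S := by
  by_cases hM : Countable M
  · exact ⟨⊤, fun x _ => Language.ElementarySubstructure.mem_top x, inferInstance⟩
  · have hL : L.card ≤ Cardinal.aleph0 := Cardinal.mk_le_aleph0
    obtain ⟨S, hS, hc⟩ := exists_elementarySubstructure_card_eq L s Cardinal.aleph0.{w} le_rfl
      (by simpa using hs.le_aleph0) (by simpa using hL) (by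
        have : Cardinal.aleph0 < Cardinal.mk M := by
          rw [← not_le, Cardinal.mk_le_aleph0_iff]; exact hM
        simpa using this.le)
    refine ⟨S, hS, ?_⟩
    rw [← Cardinal.mk_le_aleph0_iff]
    simpa using hc.le

/-- In an `ω`-categorical structure a decreasing sequence of realized formulas has a common
realization. -/
theorem OmegaCategorical.exists_realize [Countable L.Symbols] (hcat : OmegaCategorical L X)
    {ι : Type*} [Finite ι] (φ : ℕ → L.Formula ι) (hne : ∀ k, ∃ a : ι → X, (φ k).Realize a)
    (hanti : ∀ k (a : ι → X), (φ (k + 1)).Realize a → (φ k).Realize a) :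
    ∃ a : ι → X, ∀ k, (φ k).Realize a := by
  have hanti' : ∀ {j k}, j ≤ k → ∀ a : ι → X, (φ k).Realize a → (φ j).Realize a := by
    intro j k hjk
    induction hjk with
    | refl => exact fun a h => h
    | step _ ih => exact fun a h => ih a (hanti _ a h)
  choose a ha using hne
  rcases isEmpty_or_nonempty X with hX | hX
  · exact ⟨a 0, fun k => Subsingleton.elim (a k) (a 0) ▸ ha k⟩
  -- In a nonprincipal ultrapower the sequence of realizations is itself a common realization, since
  -- `a n` satisfies `φ k` for all n ≥ k.
  let U : Ultrafilter ℕ := Filter.hyperfilter ℕ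
  let M : Type w := (U : Filter ℕ).Product fun _ => X
  let b : ι → M := fun i => ((fun k => a k i : ℕ → X) : (U : Filter ℕ).Product fun _ => X)
  have hb : ∀ k, (φ k).Realize b := fun k => by
    refine (Ultraproduct.realize_formula_cast (φ k) (fun i k => a k i)).2 ?_
    have : ∀ᶠ n in Filter.atTop, (φ k).Realize (a n) :=
      (Filter.eventually_ge_atTop k).mono fun n hn => hanti' hn _ (ha n)
    rw [← Nat.cofinite_eq_atTop] at this
    exact Filter.hyperfilter_le_cofinite this
  have hXM : X ≅[L] M := elementarilyEquivalent_iff.2 fun ψ => by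
    rw [Ultraproduct.sentence_realize]; simp
  -- A countable elementary substructure around the realization is isomorphic to `X` by
  -- categoricity, so the realization can be pulled back.
  obtain ⟨S, hS, hSc⟩ := exists_countable_elementarySubstructure (L := L) (Set.range b)
    (Set.countable_range b)
  obtain ⟨e⟩ := hcat.2 S hSc (hXM.trans S.elementarilyEquivalent.symm)
  let c : ι → S := fun i => ⟨b i, hS ⟨i, rfl⟩⟩
  refine ⟨e.symm ∘ c, fun k => ?_⟩
  rw [← StrongHomClass.realize_formula e]
  rw [← S.subtype.map_formula]
  convert hb k using 1
  funext i
  simp [c]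

/-- The type of `a` is isolated by a formula. -/
def IsolatedTuple (L : FirstOrder.Language.{u, v}) {X : Type w} [L.Structure X] {ι : Type*}
    (a : ι → X) : Prop :=
  ∃ φ : L.Formula ι, φ.Realize a ∧
    ∀ ψ : L.Formula ι, ψ.Realize a → ∀ b : ι → X, φ.Realize b → ψ.Realize b

/-- Density of isolated types. If `φ` contained none, every realized formula below it could be
split; enumerating the countably many tuples of `X` and excluding one at each step gives a
decreasing sequence of realized formulas with no common realization, against `exists_realize`. -/
theorem OmegaCategorical.exists_isolated [Countable L.Symbols] (hcat : OmegaCategorical L X)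
    {ι : Type*} [Finite ι] (φ : L.Formula ι) (a₀ : ι → X) (h₀ : φ.Realize a₀) :
    ∃ a : ι → X, φ.Realize a ∧ IsolatedTuple L a := by
  by_contra! hno
  have := hcat.1
  have : Nonempty (ι → X) := ⟨a₀⟩
  obtain ⟨en, hen⟩ := exists_surjective_nat (ι → X)
  have step : ∀ (ψ : {ψ : L.Formula ι // (∃ a : ι → X, ψ.Realize a) ∧
      ∀ a : ι → X, ψ.Realize a → φ.Realize a}) (x : ι → X),
      ∃ ψ' : {ψ : L.Formula ι // (∃ a : ι → X, ψ.Realize a) ∧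
        ∀ a : ι → X, ψ.Realize a → φ.Realize a},
        (∀ a : ι → X, ψ'.1.Realize a → ψ.1.Realize a) ∧ ¬ ψ'.1.Realize x := by
    rintro ⟨ψ, ⟨a, ha⟩, hψ⟩ x
    by_cases hx : ψ.Realize x
    swap
    · exact ⟨⟨ψ, ⟨a, ha⟩, hψ⟩, fun _ h => h, hx⟩
    have h1 := hno a (hψ a ha)
    simp only [IsolatedTuple, not_exists, not_and, not_forall] at h1
    obtain ⟨θ, hθa, b, hb, hθb⟩ := h1 ψ ha
    by_cases hxθ : θ.Realize x
    · refine ⟨⟨ψ ⊓ θ.not, ⟨b, ?_⟩, ?_⟩, ?_, ?_⟩ <;> simp_all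
    · refine ⟨⟨ψ ⊓ θ, ⟨a, ?_⟩, ?_⟩, ?_, ?_⟩ <;> simp_all
  choose next hnext using step
  let Φ : ℕ → {ψ : L.Formula ι // (∃ a : ι → X, ψ.Realize a) ∧
      ∀ a : ι → X, ψ.Realize a → φ.Realize a} :=
    fun n => Nat.rec ⟨φ, ⟨a₀, h₀⟩, fun _ h => h⟩ (fun k ψ => next ψ (en k)) n
  obtain ⟨a, ha⟩ := hcat.exists_realize (fun k => (Φ k).1) (fun k => (Φ k).2.1)
    (fun k a h => (hnext (Φ k) (en k)).1 a h)
  obtain ⟨k, rfl⟩ := hen a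
  exact (hnext (Φ k) (en k)).2 (ha (k + 1))

/-- The image of the isolating formula under the coordinate map is definable, and the formula
defining it isolates the new tuple. -/
theorem IsolatedTuple.comp {ι κ : Type*} [Finite ι] [Finite κ] {a : ι → X}
    (ha : IsolatedTuple L a) (f : κ → ι) : IsolatedTuple L (a ∘ f) := by
  obtain ⟨φ, hφ, hiso⟩ := ha
  have hd : (∅ : Set X).Definable L (Set.ofPred φ.Realize) := Set.empty_definable_iff.2 ⟨φ, rfl⟩
  obtain ⟨ψ, hψ⟩ := Set.empty_definable_iff.1 (hd.image_comp f)
  have hψ' : ∀ c : κ → X, ψ.Realize c ↔ ∃ b : ι → X, φ.Realize b ∧ b ∘ f = c := fun c => by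
    have := Set.ext_iff.1 hψ c
    exact this.symm
  refine ⟨ψ, (hψ' _).2 ⟨a, hφ, rfl⟩, fun θ hθ c hc => ?_⟩
  obtain ⟨b, hb, rfl⟩ := (hψ' c).1 hc
  have := hiso (θ.relabel f) (by rwa [Formula.realize_relabel]) b hb
  rwa [Formula.realize_relabel] at this

/-- An isolated tuple `b` below `φ` and `θ` has an initial part of the same type as `a`, because `θ`
isolates that type. The projection of the formula isolating `b` therefore holds at `a`, which lifts
to the required `y`. -/
theorem OmegaCategorical.exists_isolated_extension [Countable L.Symbols]
    (hcat : OmegaCategorical L X) {ι : Type*} [Finite ι] {a : ι → X} (ha : IsolatedTuple L a)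
    (φ : L.Formula (ι ⊕ Fin 1)) (y : Fin 1 → X) (hy : φ.Realize (Sum.elim a y)) :
    ∃ y : Fin 1 → X, φ.Realize (Sum.elim a y) ∧ IsolatedTuple L (Sum.elim a y) := by
  obtain ⟨θ, hθ, hiso⟩ := ha
  obtain ⟨b, hb, χ, hχ, hχiso⟩ := hcat.exists_isolated (φ ⊓ θ.relabel Sum.inl) (Sum.elim a y)
    (by simp [hy, Formula.realize_relabel, hθ, Sum.elim_comp_inl])
  simp only [Formula.realize_inf, Formula.realize_relabel] at hb
  have hd : (∅ : Set X).Definable L (Set.ofPred χ.Realize) := Set.empty_definable_iff.2 ⟨χ, rfl⟩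
  obtain ⟨ψ, hψ⟩ := Set.empty_definable_iff.1 (hd.image_comp (Sum.inl : ι → ι ⊕ Fin 1))
  have hψ' : ∀ c : ι → X, ψ.Realize c ↔ ∃ b : ι ⊕ Fin 1 → X, χ.Realize b ∧ b ∘ Sum.inl = c :=
    fun c => (Set.ext_iff.1 hψ c).symm
  have hψa : ψ.Realize a := by
    by_contra hna
    have := hiso ψ.not (by simpa using hna) _ hb.2
    exact (by simpa using this : ¬ ψ.Realize (b ∘ Sum.inl)) ((hψ' _).2 ⟨b, hχ, rfl⟩)
  obtain ⟨c, hc, rfl⟩ := (hψ' a).1 hψa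
  refine ⟨c ∘ Sum.inr, ?_, ?_⟩
  · rw [Sum.elim_comp_inl_inr]
    exact hχiso φ hb.1 c hc
  · rw [Sum.elim_comp_inl_inr]
    refine ⟨χ, hc, fun ζ hζ d hd => ?_⟩
    refine hχiso ζ ?_ d hd
    by_contra hn
    exact (by simpa using hχiso ζ.not (by simpa using hn) c hc : ¬ ζ.Realize c) hζ

end Types

/-! ### The Ryll-Nardzewski theorem: all types are isolated, and finitely many of each arity. -/

section RyllNardzewski

open FirstOrder.Language

variable {L : FirstOrder.Language.{u, v}} {X : Type w} [L.Structure X]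

/-- One step of the construction of an atomic model: `t` is a Tarski-Vaught demand with parameters
`t.1`, and a witness is added while the finite set stays isolated. Demands whose parameters are not
yet present are skipped. -/
theorem OmegaCategorical.exists_isolated_finset_extension [Countable L.Symbols]
    (hcat : OmegaCategorical L X) (F : Finset X)
    (hF : IsolatedTuple L (fun x : F => (x : X)))
    (t : Σ E : Finset X, L.Formula ((E : Set X) ⊕ Fin 1)) :
    ∃ F' : Finset X, IsolatedTuple L (fun x : F' => (x : X)) ∧ F ⊆ F' ∧
      (t.1 ⊆ F → (∃ y : Fin 1 → X, t.2.Realize (Sum.elim (fun x => (x : X)) y)) →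
        ∃ y : Fin 1 → X, y 0 ∈ F' ∧ t.2.Realize (Sum.elim (fun x => (x : X)) y)) := by
  classical
  by_cases h : t.1 ⊆ F ∧ ∃ y : Fin 1 → X, t.2.Realize (Sum.elim (fun x => (x : X)) y)
  swap
  · exact ⟨F, hF, subset_rfl, fun h1 h2 => (h ⟨h1, h2⟩).elim⟩
  obtain ⟨hE, y, hy⟩ := h
  obtain ⟨E, φ⟩ := t
  let j : (E : Set X) ⊕ Fin 1 → F ⊕ Fin 1 := Sum.map (fun x => ⟨x, hE x.2⟩) id
  have hj : ∀ y : Fin 1 → X, Sum.elim (fun x : F => (x : X)) y ∘ j =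
      Sum.elim (fun x : (E : Set X) => (x : X)) y := fun y => by
    funext i
    rcases i with i | i <;> rfl
  obtain ⟨z, hz, hiso⟩ := hcat.exists_isolated_extension hF (φ.relabel j) y
    (by rw [Formula.realize_relabel, hj]; exact hy)
  rw [Formula.realize_relabel, hj] at hz
  refine ⟨insert (z 0) F, ?_, Finset.subset_insert _ _, fun _ _ => ⟨z, by simp, hz⟩⟩
  let f : (insert (z 0) F : Finset X) → F ⊕ Fin 1 := fun x =>
    if hx : (x : X) ∈ F then Sum.inl ⟨x, hx⟩ else Sum.inr 0
  have hf : (Sum.elim (fun x : F => (x : X)) z) ∘ f =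
      fun x : (insert (z 0) F : Finset X) => (x : X) := by
    funext x
    by_cases hx : (x : X) ∈ F
    · simp [f, hx]
    · have := (Finset.mem_insert.1 x.2).resolve_right hx
      have hfx : f x = Sum.inr 0 := dif_neg hx
      rw [Function.comp_apply, hfx, this, Sum.elim_inr]
  rw [← hf]
  exact hiso.comp f

/-- The union of a chain of isolated finite sets that meets all Tarski-Vaught demands is an atomic
elementary substructure. -/
theorem OmegaCategorical.exists_isolated_elementarySubstructure [Countable L.Symbols]
    (hcat : OmegaCategorical L X) :
    ∃ S : L.ElementarySubstructure X, ∀ {ι : Type*} [Finite ι] (a : ι → X),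
      (∀ i, a i ∈ S) → IsolatedTuple L a := by
  classical
  have := hcat.1
  have hc : Countable (Σ E : Finset X, L.Formula ((E : Set X) ⊕ Fin 1)) := by
    have : ∀ E : Finset X, Countable (L.Formula ((E : Set X) ⊕ Fin 1)) :=
      fun E => countable_formula _
    infer_instance
  have : Nonempty (Σ E : Finset X, L.Formula ((E : Set X) ⊕ Fin 1)) := ⟨⟨∅, ⊥⟩⟩
  obtain ⟨en, hen⟩ := exists_surjective_nat (Σ E : Finset X, L.Formula ((E : Set X) ⊕ Fin 1))
  have hemp : IsolatedTuple L (fun x : (∅ : Finset X) => (x : X)) := by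
    obtain ⟨a, -, ha⟩ := hcat.exists_isolated (ι := (∅ : Finset X)) ⊤
      (fun x => (x : X)) (by simp)
    have : a = fun x : (∅ : Finset X) => (x : X) := funext fun x => absurd x.2 (Finset.notMem_empty _)
    rwa [this] at ha
  choose next hiso hsub hreal using hcat.exists_isolated_finset_extension
  -- Unpairing makes every demand recur at arbitrarily late stages: demand `k` is treated at stage
  -- `Nat.pair k m` ≥ `m`, when its parameters have already entered.
  let Φ : ℕ → {F : Finset X // IsolatedTuple L (fun x : F => (x : X))} := fun n =>
    Nat.rec ⟨∅, hemp⟩ (fun k F => ⟨next F.1 F.2 (en k.unpair.1), hiso F.1 F.2 _⟩) n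
  have hmono : Monotone fun n => (Φ n).1 :=
    monotone_nat_of_le_succ fun n => hsub (Φ n).1 (Φ n).2 (en n.unpair.1)
  let A : Set X := ⋃ n, ((Φ n).1 : Set X)
  have hfin : ∀ E : Finset X, (E : Set X) ⊆ A → ∃ n, E ⊆ (Φ n).1 := by
    intro E
    induction E using Finset.induction_on with
    | empty => exact fun _ => ⟨0, by simp⟩
    | insert x E _ ih =>
      intro h
      rw [Finset.coe_insert, Set.insert_subset_iff] at h
      obtain ⟨n, hn⟩ := ih h.2
      obtain ⟨m, hm⟩ := Set.mem_iUnion.1 h.1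
      exact ⟨max n m, Finset.insert_subset (hmono (le_max_right n m) hm)
        (hn.trans (hmono (le_max_left n m)))⟩
  have hA : L.MeetsDefinable A := by
    rintro D ⟨x, hx⟩ hD
    obtain ⟨E, hE, hD'⟩ := Set.definable_iff_finitely_definable.1 hD
    obtain ⟨φ, hφ⟩ := Set.definable_iff_exists_formula_sum.1 hD'
    have key : ∀ y : Fin 1 → X, y 0 ∈ D ↔ φ.Realize (Sum.elim (fun x => (x : X)) y) :=
      fun y => Set.ext_iff.1 hφ y
    obtain ⟨m, hm⟩ := hfin E hE
    obtain ⟨k, hk⟩ := hen ⟨E, φ⟩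
    have hstage : en (Nat.unpair (Nat.pair k m)).1 = ⟨E, φ⟩ := by rw [Nat.unpair_pair, hk]
    have h1 := hreal (Φ (Nat.pair k m)).1 (Φ (Nat.pair k m)).2 (en (Nat.pair k m).unpair.1)
    have hΦ : (Φ (Nat.pair k m + 1)).1 =
        next (Φ (Nat.pair k m)).1 (Φ (Nat.pair k m)).2 (en (Nat.pair k m).unpair.1) := rfl
    rw [← hΦ, hstage] at h1
    obtain ⟨y, hy, hyr⟩ := h1 (hm.trans (hmono (Nat.right_le_pair k m)))
      ⟨fun _ => x, (key fun _ => x).1 hx⟩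
    exact ⟨y 0, (key y).2 hyr, Set.mem_iUnion.2 ⟨Nat.pair k m + 1, hy⟩⟩
  refine ⟨hA.toElementarySubstructure, fun {ι} _ a ha => ?_⟩
  have ha' : ∀ i, a i ∈ A := fun i => by
    have : a i ∈ (Substructure.closure L A : Set X) := ha i
    rwa [hA.closure_eq_self] at this
  have := Fintype.ofFinite ι
  obtain ⟨n, hn⟩ := hfin (Finset.univ.image a) (by simpa [Set.range_subset_iff] using ha')
  exact (Φ n).2.comp (fun i => ⟨a i, hn (by simp)⟩)

/-- In an `ω`-categorical structure all types of tuples are isolated. -/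
theorem OmegaCategorical.isolated [Countable L.Symbols] (hcat : OmegaCategorical L X)
    {ι : Type*} [Finite ι] (a : ι → X) : IsolatedTuple L a := by
  obtain ⟨S, hS⟩ := hcat.exists_isolated_elementarySubstructure
  have := hcat.1
  -- By categoricity `X` is isomorphic to its atomic elementary substructure, so it is atomic too.
  obtain ⟨e⟩ := hcat.2 S inferInstance S.elementarilyEquivalent.symm
  have key : ∀ (φ : L.Formula ι) (b : ι → X),
      φ.Realize b ↔ φ.Realize (fun i => (e (b i) : X)) := fun φ b => by
    rw [← StrongHomClass.realize_formula e, ← S.subtype.map_formula]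
    rfl
  obtain ⟨φ, hφ, hiso⟩ := hS (fun i => (e (a i) : X)) fun i => (e (a i)).2
  refine ⟨φ, (key φ a).2 hφ, fun ψ hψ b hb => (key ψ b).2 ?_⟩
  exact hiso ψ ((key ψ a).1 hψ) _ ((key φ b).1 hb)

/-- In an `ω`-categorical structure finitely many isolating formulas cover all tuples. -/
theorem OmegaCategorical.exists_finite_isolating [Countable L.Symbols]
    (hcat : OmegaCategorical L X) (ι : Type*) [Finite ι] :
    ∃ T : Set (ι → X), T.Finite ∧ ∀ a : ι → X, ∃ b ∈ T,
      ∀ ψ : L.Formula ι, ψ.Realize a ↔ ψ.Realize b := by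
  have := hcat.1
  rcases isEmpty_or_nonempty (ι → X) with hE | hE
  · exact ⟨∅, Set.finite_empty, fun a => hE.elim a⟩
  choose θ hθ hiso using fun a : ι → X => hcat.isolated (L := L) a
  have hiff : ∀ a b : ι → X, (θ b).Realize a → ∀ ψ : L.Formula ι, ψ.Realize a ↔ ψ.Realize b := by
    refine fun a b h ψ => ⟨fun ha => ?_, fun hb => hiso b ψ hb a h⟩
    by_contra hb
    exact (by simpa using hiso b ψ.not (by simpa using hb) a h : ¬ ψ.Realize a) ha
  obtain ⟨en, hen⟩ := exists_surjective_nat (ι → X)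
  -- `Φ n` says that none of the first `n` isolating formulas holds. If every `Φ n` were realized, a
  -- common realization would violate its own isolating formula; so some `Φ k` is empty and `k`
  -- types suffice.
  let Φ : ℕ → L.Formula ι := fun n => Nat.rec ⊤ (fun k φ => φ ⊓ (θ (en k)).not) n
  have hΦ : ∀ n (a : ι → X), (Φ n).Realize a ↔ ∀ k < n, ¬ (θ (en k)).Realize a := by
    intro n a
    induction n with
    | zero => simp [Φ]
    | succ n ih =>
      change (Φ n ⊓ (θ (en n)).not).Realize a ↔ _
      rw [Formula.realize_inf, ih, Formula.realize_not]
      exact ⟨fun h k hk => (Nat.lt_succ_iff_lt_or_eq.1 hk).elim (h.1 k) fun e => e ▸ h.2,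
        fun h => ⟨fun k hk => h k (hk.trans n.lt_succ_self), h n n.lt_succ_self⟩⟩
  by_cases h : ∀ k, ∃ a : ι → X, (Φ k).Realize a
  · obtain ⟨a, ha⟩ := hcat.exists_realize Φ h fun k a h =>
      (hΦ k a).2 fun j hj => (hΦ (k + 1) a).1 h j (hj.trans k.lt_succ_self)
    obtain ⟨k, rfl⟩ := hen a
    exact ((hΦ (k + 1) _).1 (ha (k + 1)) k k.lt_succ_self (hθ _)).elim
  · push Not at h
    obtain ⟨k, hk⟩ := h
    refine ⟨en '' Set.Iio k, (Set.finite_Iio k).image en, fun a => ?_⟩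
    have := hk a
    rw [hΦ] at this
    push Not at this
    obtain ⟨j, hj, hja⟩ := this
    exact ⟨en j, ⟨j, hj, rfl⟩, hiff a (en j) hja⟩

end RyllNardzewski

/-! ### Automorphism orbits of tuples: types, oligomorphy and definability. -/

section Orbits

open FirstOrder.Language

variable {L : FirstOrder.Language.{u, v}} {X : Type w} [L.Structure X]

instance autAction : MulAction (X ≃[L] X) X where
  smul g x := g x
  one_smul _ := rfl
  mul_smul _ _ _ := rfl

/-- An element `t(a)` of the closure is determined by the type of the tuple `(a, t(a))`, because the
formula `t(a) = z` belongs to it, and there are finitely many such types. -/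
theorem OmegaCategorical.finite_closure [Countable L.Symbols] (hcat : OmegaCategorical L X)
    {ι : Type*} [Finite ι] (a : ι → X) : Finite (Substructure.closure L (Set.range a)) := by
  obtain ⟨T, hT, hcov⟩ := hcat.exists_finite_isolating (ι ⊕ Fin 1)
  choose r hr hrt using hcov
  have := hT.to_subtype
  refine Finite.of_injective (β := T)
    (fun x : Substructure.closure L (Set.range a) =>
      ⟨r (Sum.elim a fun _ => (x : X)), hr _⟩) fun x y hxy => ?_
  obtain ⟨t, ht⟩ := Substructure.mem_closure_iff_exists_term.1 x.2
  choose s hs using fun i : Set.range a => i.2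
  have hts : t.realize ((↑) : Set.range a → X) = (t.relabel s).realize a := by
    rw [Term.realize_relabel]
    congr 1
    funext i
    exact (hs i).symm
  let ψ : L.Formula (ι ⊕ Fin 1) :=
    Term.equal ((t.relabel s).relabel Sum.inl) (Term.var (Sum.inr 0))
  have hψ : ∀ z : X, ψ.Realize (Sum.elim a fun _ => z) ↔ (t.relabel s).realize a = z := fun z => by
    simp [ψ, Formula.realize_equal]
    exact Iff.rfl
  have h1 := (hrt (Sum.elim a fun _ => (x : X)) ψ).trans
    ((congrArg ψ.Realize (congrArg Subtype.val hxy)).to_iff.trans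
      (hrt (Sum.elim a fun _ => (y : X)) ψ).symm)
  rw [hψ, hψ, ← hts, ht] at h1
  exact Subtype.ext (h1.1 rfl)

theorem mem_closure_range_iff {ι : Type*} (a : ι → X) (x : X) :
    x ∈ Substructure.closure L (Set.range a) ↔ ∃ t : L.Term ι, t.realize a = x := by
  constructor
  · intro hx
    obtain ⟨t, ht⟩ := Substructure.mem_closure_iff_exists_term.1 hx
    choose s hs using fun i : Set.range a => i.2
    refine ⟨t.relabel s, ?_⟩
    rw [Term.realize_relabel, ← ht]
    congr 1
    funext i
    exact hs i
  · rintro ⟨t, rfl⟩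
    exact t.realize_mem a fun i => Substructure.subset_closure ⟨i, rfl⟩

/-- Tuples with the same type generate isomorphic substructures. -/
theorem exists_equiv_closure {ι : Type*} (a b : ι → X)
    (hab : ∀ ψ : L.Formula ι, ψ.Realize a ↔ ψ.Realize b) :
    ∃ f : Substructure.closure L (Set.range a) ≃[L] Substructure.closure L (Set.range b),
      ∀ i, (f ⟨a i, Substructure.subset_closure ⟨i, rfl⟩⟩ : X) = b i := by
  have heq : ∀ t s : L.Term ι, t.realize a = s.realize a ↔ t.realize b = s.realize b := by
    intro t s
    simpa [Formula.realize_equal] using hab (Term.equal t s)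
  -- The isomorphism sends `t(a)` to `t(b)`. By `heq` the value does not depend on the term chosen
  -- to name a point.
  choose p hp using fun x : Substructure.closure L (Set.range a) =>
    (mem_closure_range_iff a (x : X)).1 x.2
  choose q hq using fun x : Substructure.closure L (Set.range b) =>
    (mem_closure_range_iff b (x : X)).1 x.2
  refine ⟨{ toFun := fun x => ⟨(p x).realize b, (mem_closure_range_iff b _).2 ⟨_, rfl⟩⟩
            invFun := fun x => ⟨(q x).realize a, (mem_closure_range_iff a _).2 ⟨_, rfl⟩⟩
            left_inv := fun x => Subtype.ext ?_
            right_inv := fun x => Subtype.ext ?_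
            map_fun' := fun {n} F x => Subtype.ext ?_
            map_rel' := fun {n} R x => ?_ }, fun i => ?_⟩
  · refine Eq.trans ?_ (hp x)
    exact (heq _ _).2 (hq _)
  · refine Eq.trans ?_ (hq x)
    exact (heq _ _).1 (hp _)
  · change (p (Structure.funMap F x)).realize b =
      Structure.funMap F fun i => (p (x i)).realize b
    refine (heq _ (Term.func F fun i => p (x i))).1 ((hp _).trans ?_)
    change Structure.funMap F (fun i => (x i : X)) = Structure.funMap F _
    congr 1
    funext i
    exact (hp (x i)).symm
  · have h := hab (Relations.formula R fun i => p (x i))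
    simp only [Formula.realize_rel, hp] at h
    exact h.symm
  · change (p _).realize b = b i
    exact (heq _ (Term.var i)).1 (hp _)

theorem exists_aut_of_same_type [Countable L.Symbols] (hcat : OmegaCategorical L X)
    (hhom : Homogeneous L X) {ι : Type*} [Finite ι] (a b : ι → X)
    (hab : ∀ ψ : L.Formula ι, ψ.Realize a ↔ ψ.Realize b) :
    ∃ g : X ≃[L] X, ∀ i, g (a i) = b i := by
  obtain ⟨f, hf⟩ := exists_equiv_closure a b hab
  obtain ⟨g, hg⟩ := hhom _ _ (hcat.finite_closure a) (hcat.finite_closure b) f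
  exact ⟨g, fun i => (hg _).trans (hf i)⟩

/-- The automorphism group is oligomorphic. -/
theorem exists_finite_orbit_representatives [Countable L.Symbols] (hcat : OmegaCategorical L X)
    (hhom : Homogeneous L X) (ι : Type*) [Finite ι] :
    ∃ T : Set (ι → X), T.Finite ∧ ∀ a : ι → X, ∃ b ∈ T, ∃ g : X ≃[L] X, ∀ i, g (b i) = a i := by
  obtain ⟨T, hT, h⟩ := hcat.exists_finite_isolating ι
  refine ⟨T, hT, fun a => ?_⟩
  obtain ⟨b, hb, hab⟩ := h a
  exact ⟨b, hb, exists_aut_of_same_type hcat hhom b a fun ψ => (hab ψ).symm⟩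

/-- Tuples of the same type are conjugate, so an invariant set is a union of types; there are
finitely many, each defined by its isolating formula. -/
theorem definable_of_invariant [Countable L.Symbols] (hcat : OmegaCategorical L X)
    (hhom : Homogeneous L X) {ι : Type*} [Finite ι] (s : Set (ι → X))
    (hs : ∀ (g : X ≃[L] X), ∀ a ∈ s, (fun i => g (a i)) ∈ s) : (∅ : Set X).Definable L s := by
  obtain ⟨T, hT, h⟩ := hcat.exists_finite_isolating ι
  choose θ hθ hiso using fun a : ι → X => hcat.isolated (L := L) a
  have : s = ⋃ b ∈ (hT.subset (Set.inter_subset_left (s := T) (t := s))).toFinset,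
      Set.ofPred (θ b).Realize := by
    ext a
    simp only [Set.Finite.mem_toFinset, Set.mem_iUnion, exists_prop]
    constructor
    · intro ha
      obtain ⟨b, hb, hab⟩ := h a
      obtain ⟨g, hg⟩ := exists_aut_of_same_type hcat hhom a b hab
      refine ⟨b, ⟨hb, ?_⟩, (hab _).2 (hθ b)⟩
      have := hs g a ha
      rwa [funext hg] at this
    · rintro ⟨b, ⟨-, hb⟩, hab⟩
      obtain ⟨g, hg⟩ := exists_aut_of_same_type hcat hhom b a fun ψ =>
        ⟨fun h => hiso b ψ h a hab, fun h => by
          by_contra hn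
          exact (by simpa using hiso b ψ.not (by simpa using hn) a hab : ¬ ψ.Realize a) h⟩
      have := hs g b hb
      rwa [funext hg] at this
  rw [this]
  exact Set.definable_biUnion_finset (fun b => Set.empty_definable_iff.2 ⟨θ b, rfl⟩) _

end Orbits

/-! ### Algebraic closure and supports of open subgroups. -/

section AlgebraicClosure

/-- Orbit-stabilizer. Phrasing algebraicity by relative indices turns its transitivity into
transitivity of finite index. -/
theorem finite_orbit_iff {G X : Type*} [Group G] [MulAction G X] (V : Subgroup G) (b : X) :
    {c : X | ∃ g ∈ V, g • b = c}.Finite ↔ (MulAction.stabilizer G b).relIndex V ≠ 0 := by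
  have h1 : (MulAction.stabilizer G b).relIndex V = (MulAction.stabilizer V b).index := by
    rw [Subgroup.relIndex]
    congr 1
  have h2 : {c : X | ∃ g ∈ V, g • b = c} = MulAction.orbit V b := by
    ext c
    exact ⟨fun ⟨g, hg, h⟩ => ⟨⟨g, hg⟩, h⟩, fun ⟨g, h⟩ => ⟨g, g.2, h⟩⟩
  rw [h1, MulAction.index_stabilizer, h2]
  refine ⟨fun h => ((Set.ncard_pos h).2 ⟨b, MulAction.mem_orbit_self b⟩).ne', fun h => ?_⟩
  exact Set.finite_of_ncard_ne_zero h

theorem relIndex_fixingSubgroup_ne_zero {G X : Type*} [Group G] [MulAction G X]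
    (V : Subgroup G) {E : Set X} (hE : E.Finite)
    (h : ∀ e ∈ E, (MulAction.stabilizer G e).relIndex V ≠ 0) :
    (fixingSubgroup G E).relIndex V ≠ 0 := by
  have := hE.to_subtype
  have h1 : fixingSubgroup G E = ⨅ e : E, MulAction.stabilizer G (e : X) := by
    ext g
    simp [mem_fixingSubgroup_iff, Subgroup.mem_iInf]
  rw [h1]
  exact Subgroup.relIndex_iInf_ne_zero fun e => h e e.2

open FirstOrder.Language

variable {L : FirstOrder.Language.{u, v}} {X : Type w} [L.Structure X]

theorem algebraicallyClosed_iff (A : L.Substructure X) :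
    AlgebraicallyClosed A ↔ ∀ b : X, (MulAction.stabilizer (X ≃[L] X) b).relIndex
      (fixingSubgroup (X ≃[L] X) (A : Set X)) ≠ 0 → b ∈ A := by
  refine forall_congr' fun b => ?_
  rw [← finite_orbit_iff]
  simp only [mem_fixingSubgroup_iff]
  rfl

/-- Every finite set is contained in a finite algebraically closed substructure. -/
theorem exists_algebraicallyClosed [Countable L.Symbols] (hcat : OmegaCategorical L X)
    (hhom : Homogeneous L X) (C : Set X) (hC : C.Finite) :
    ∃ A : L.Substructure X, Finite A ∧ AlgebraicallyClosed A ∧ C ⊆ A := by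
  let V := fixingSubgroup (X ≃[L] X) C
  let S : Set X := {b | (MulAction.stabilizer (X ≃[L] X) b).relIndex V ≠ 0}
  have hCS : C ⊆ S := fun c hc => by
    have : V ≤ MulAction.stabilizer (X ≃[L] X) c := fun g hg =>
      (mem_fixingSubgroup_iff _).1 hg c hc
    change _ ≠ 0
    rw [Subgroup.relIndex_eq_one.2 this]
    exact one_ne_zero
  have hS : S.Finite := by
    have := hC.to_subtype
    obtain ⟨T, hT, hcov⟩ := exists_finite_orbit_representatives hcat hhom (C ⊕ Fin 1)
    have hsub : S ⊆ ⋃ t ∈ T, {b | b ∈ S ∧ ∃ g : X ≃[L] X,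
        ∀ i, g (t i) = Sum.elim (fun c : C => (c : X)) (fun _ => b) i} := fun b hb => by
      obtain ⟨t, ht, g, hg⟩ := hcov (Sum.elim (fun c : C => (c : X)) fun _ => b)
      exact Set.mem_biUnion ht ⟨hb, g, hg⟩
    -- For one representative `t`, all points `b` for which `(C, b)` is conjugate to `t` lie in a
    -- single `V`-orbit, which is finite for `b` in `S`.
    refine (hT.biUnion fun t _ => ?_).subset hsub
    rcases Set.eq_empty_or_nonempty {b | b ∈ S ∧ ∃ g : X ≃[L] X,
        ∀ i, g (t i) = Sum.elim (fun c : C => (c : X)) (fun _ => b) i} with h | ⟨b, hb, g, hg⟩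
    · rw [h]; exact Set.finite_empty
    · refine ((finite_orbit_iff V b).2 hb).subset ?_
      rintro c ⟨-, k, hk⟩
      refine ⟨k * g⁻¹, (mem_fixingSubgroup_iff _).2 fun x hx => ?_, ?_⟩
      · have h1 : g • t (Sum.inl ⟨x, hx⟩) = x := hg (Sum.inl ⟨x, hx⟩)
        have h2 : k • t (Sum.inl ⟨x, hx⟩) = x := hk (Sum.inl ⟨x, hx⟩)
        rw [mul_smul, inv_smul_eq_iff.2 h1.symm, h2]
      · have h1 : g • t (Sum.inr 0) = b := hg (Sum.inr 0)
        have h2 : k • t (Sum.inr 0) = c := hk (Sum.inr 0)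
        rw [mul_smul, inv_smul_eq_iff.2 h1.symm, h2]
  let A : L.Substructure X :=
    { carrier := S
      fun_mem := fun {n} F x hx => by
        have h1 : (⨅ i, MulAction.stabilizer (X ≃[L] X) (x i)).relIndex V ≠ 0 :=
          Subgroup.relIndex_iInf_ne_zero fun i => hx i
        refine fun h0 => h1 (Subgroup.relIndex_eq_zero_of_le_left ?_ h0)
        intro g hg
        rw [Subgroup.mem_iInf] at hg
        change g (Structure.funMap F x) = _
        rw [g.map_fun]
        congr 1
        exact funext hg }
  refine ⟨A, hS.to_subtype, ?_, hCS⟩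
  rw [algebraicallyClosed_iff]
  -- `S` is finite and each of its points has a stabilizer of finite index in `V`. Hence the fixer
  -- of `S` has finite index in `V`, and a point algebraic over `S` is algebraic over `C`.
  exact fun b hb => Subgroup.relIndex_ne_zero_trans hb
    (relIndex_fixingSubgroup_ne_zero V hS fun e he => he)

/-- Weak elimination of imaginaries for open subgroups of the automorphism group. -/
theorem exists_finite_support [Countable L.Symbols] (hcat : OmegaCategorical L X)
    (hhom : Homogeneous L X) (hwei : WeakElimination L X) (W : Subgroup (X ≃[L] X))
    (C : Set X) (hC : C.Finite) (hW : fixingSubgroup (X ≃[L] X) C ≤ W) :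
    ∃ D : Set X, fixingSubgroup (X ≃[L] X) D ≤ W ∧
      ∀ A : L.Substructure X, AlgebraicallyClosed A →
        W.relIndex (fixingSubgroup (X ≃[L] X) (A : Set X)) ≠ 0 → D ⊆ A := by
  obtain ⟨m, c, rfl⟩ : ∃ (m : ℕ) (c : Fin m → X), Set.range c = C := by
    have := hC.to_subtype
    obtain ⟨m, ⟨e⟩⟩ := Finite.exists_equiv_fin C
    exact ⟨m, fun i => e.symm i, by
      rw [← Function.comp_def, Set.range_comp, e.symm.range_eq_univ, Set.image_univ,
        Subtype.range_coe]⟩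
  have hstab : ∀ g h : X ≃[L] X, g • c = h • c → g⁻¹ * h ∈ W := fun g h hgh => by
    refine hW ((mem_fixingSubgroup_iff _).2 ?_)
    rintro _ ⟨i, rfl⟩
    rw [mul_smul, inv_smul_eq_iff]
    exact (congrFun hgh i).symm
  -- The imaginary coding `W`: the class of `c` under the invariant, hence definable, relation on
  -- the orbit `G • c` that identifies `g • c` with `h • c` when `g⁻¹ * h ∈ W`. The setwise
  -- stabilizer of `α` is `W`.
  let α : Set (Fin m → X) := {x | ∃ g ∈ W, x = g • c}
  have hα : IsImaginary L α := by
    refine ⟨{x | ∃ g : X ≃[L] X, x = g • c},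
      fun x y => ∃ g h : X ≃[L] X, x = g • c ∧ y = h • c ∧ g⁻¹ * h ∈ W, ?_, ?_, ?_, ?_, ?_, ?_,
      c, ⟨1, (one_smul _ c).symm⟩, ?_⟩
    · refine definable_of_invariant hcat hhom _ ?_
      rintro k _ ⟨g, rfl⟩
      exact ⟨k * g, (mul_smul k g c).symm⟩
    · refine definable_of_invariant hcat hhom _ ?_
      rintro k z ⟨g, h, hg, hh, hgh⟩
      refine ⟨k * g, k * h, ?_, ?_, by simpa [mul_assoc] using hgh⟩
      · rw [mul_smul, ← hg]; rfl
      · rw [mul_smul, ← hh]; rfl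
    · rintro x y ⟨g, h, hg, hh, -⟩
      exact ⟨⟨g, hg⟩, ⟨h, hh⟩⟩
    · rintro x ⟨g, hg⟩
      exact ⟨g, g, hg, hg, by simp⟩
    · rintro x y ⟨g, h, hg, hh, hgh⟩
      exact ⟨h, g, hh, hg, by simpa using W.inv_mem hgh⟩
    · rintro x y z ⟨g, h, hg, hh, hgh⟩ ⟨h', k, hh', hk, hhk⟩
      refine ⟨g, k, hg, hk, ?_⟩
      have := W.mul_mem (W.mul_mem hgh (hstab h h' (hh.symm.trans hh'))) hhk
      simpa [mul_assoc] using this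
    · ext x
      constructor
      · rintro ⟨g, hg, rfl⟩
        exact ⟨1, g, (one_smul _ c).symm, rfl, by simpa using hg⟩
      · rintro ⟨g, h, hg, rfl, hgh⟩
        refine ⟨h, ?_, rfl⟩
        have := W.mul_mem (hstab 1 g ((one_smul _ c).trans hg)) hgh
        simpa using this
  have hmem : ∀ g : X ≃[L] X, g • c ∈ α ↔ g ∈ W := fun g => by
    refine ⟨?_, fun hg => ⟨g, hg, rfl⟩⟩
    rintro ⟨k, hk, hgk⟩
    have := W.mul_mem hk (hstab k g hgk.symm)
    simpa using this
  have hαW : ∀ k ∈ W, ∀ x, k • x ∈ α ↔ x ∈ α := fun k hk x => by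
    constructor
    · rintro ⟨g, hg, h⟩
      exact ⟨k⁻¹ * g, W.mul_mem (W.inv_mem hk) hg, by rw [mul_smul, ← h, inv_smul_smul]⟩
    · rintro ⟨g, hg, rfl⟩
      exact ⟨k * g, W.mul_mem hk hg, (mul_smul _ _ _).symm⟩
  obtain ⟨n, φ, hfin, d, hd⟩ := hwei m α hα
  have hφ : ∀ (k : X ≃[L] X) (x : Fin m → X) (y : Fin n → X),
      φ.Realize (Sum.elim (k • x) (k • y)) ↔ φ.Realize (Sum.elim x y) := fun k x y => by
    rw [← StrongHomClass.realize_formula k (φ := φ) (v := Sum.elim x y)]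
    congr! 1
    funext i
    rcases i with i | i <;> rfl
  have hinv : ∀ k ∈ W, ∀ y : Fin n → X, α = {x | φ.Realize (Sum.elim x y)} →
      α = {x | φ.Realize (Sum.elim x (k • y))} := fun k hk y hy => by
    ext x
    rw [← hαW k⁻¹ (W.inv_mem hk) x, hy, Set.mem_ofPred_eq, Set.mem_ofPred_eq,
      ← hφ k (k⁻¹ • x) y, smul_inv_smul]
  -- The coordinates of all the codes of `α`. There are finitely many codes and `W` permutes them,
  -- so every point of `D` has a finite `W`-orbit; fixing one code already fixes `α`.
  let D : Set X := {b | ∃ y : Fin n → X, α = {x | φ.Realize (Sum.elim x y)} ∧ b ∈ Set.range y}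
  have hDfin : D.Finite := by
    refine (hfin.biUnion fun y _ => Set.finite_range y).subset ?_
    rintro b ⟨y, hy, hb⟩
    exact Set.mem_biUnion hy hb
  refine ⟨D, fun g hg => ?_, fun A hA hWA b hb => ?_⟩
  · rw [← hmem]
    have hgd : g • d = d := funext fun i =>
      (mem_fixingSubgroup_iff _).1 hg (d i) ⟨d, hd, i, rfl⟩
    have hc : c ∈ α := ⟨1, W.one_mem, (one_smul _ c).symm⟩
    have hd' : α = {x | φ.Realize (Sum.elim x d)} := hd
    rw [hd', Set.mem_ofPred_eq] at hc ⊢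
    rwa [← hgd, hφ]
  -- The stabilizer of `b` has finite index in `W`, and `W` has finite relative index in the fixer
  -- of `A`, so `b` is algebraic over `A`.
  · refine (algebraicallyClosed_iff A).1 hA b (Subgroup.relIndex_ne_zero_trans ?_ hWA)
    rw [← finite_orbit_iff]
    refine hDfin.subset ?_
    rintro _ ⟨g, hg, rfl⟩
    obtain ⟨y, hy, i, rfl⟩ := hb
    exact ⟨g • y, hinv g hg y hy, i, rfl⟩

end AlgebraicClosure

/-! ### Fixed vectors and weak closures of orbits -/

section FixedVectors

open Filter Topology ComplexConjugate

variable {G : Type*} [Group G] {H : Type*} [NormedAddCommGroup H] [InnerProductSpace ℂ H]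

/-- The vectors fixed by a subgroup. -/
def fixedVectors (π : UnitaryRep G H) (V : Subgroup G) : Submodule ℂ H where
  carrier := {ξ | ∀ g ∈ V, π g ξ = ξ}
  add_mem' ha hb g hg := by rw [map_add, ha g hg, hb g hg]
  zero_mem' g _ := map_zero _
  smul_mem' c a ha g hg := by rw [map_smul, ha g hg]

theorem mem_fixedVectors {π : UnitaryRep G H} {V : Subgroup G} {ξ : H} :
    ξ ∈ fixedVectors π V ↔ ∀ g ∈ V, π g ξ = ξ := Iff.rfl

theorem isClosed_fixedVectors (π : UnitaryRep G H) (V : Subgroup G) :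
    IsClosed (fixedVectors π V : Set H) := by
  have : (fixedVectors π V : Set H) = ⋂ g ∈ V, {ξ | π g ξ = ξ} := by
    ext ξ
    simp [mem_fixedVectors]
  rw [this]
  exact isClosed_biInter fun g _ => isClosed_eq (π g).continuous continuous_id

instance [CompleteSpace H] (π : UnitaryRep G H) (V : Subgroup G) :
    CompleteSpace (fixedVectors π V) :=
  (isClosed_fixedVectors π V).completeSpace_coe

theorem rep_mul_apply (π : UnitaryRep G H) (g k : G) (ξ : H) : π (g * k) ξ = π g (π k ξ) := by
  rw [map_mul]; rfl

theorem rep_one_apply (π : UnitaryRep G H) (ξ : H) : π 1 ξ = ξ := by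
  rw [map_one]; rfl

theorem rep_inv_apply_self (π : UnitaryRep G H) (g : G) (ξ : H) : π g⁻¹ (π g ξ) = ξ := by
  rw [← rep_mul_apply, inv_mul_cancel, rep_one_apply]

theorem rep_apply_inv_self (π : UnitaryRep G H) (g : G) (ξ : H) : π g (π g⁻¹ ξ) = ξ := by
  rw [← rep_mul_apply, mul_inv_cancel, rep_one_apply]

theorem inner_rep_right (π : UnitaryRep G H) (g : G) (ξ η : H) :
    inner ℂ η (π g ξ) = inner ℂ (π g⁻¹ η) ξ := by
  conv_rhs => rw [← (π g).inner_map_map, rep_apply_inv_self]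

/-- `θ` belongs to the weak closure of the orbit `V ξ`. -/
def InWeakOrbit (π : UnitaryRep G H) (V : Subgroup G) (ξ θ : H) : Prop :=
  ∀ (E : Finset H) (ε : ℝ), 0 < ε → ∃ g ∈ V, ∀ η ∈ E, ‖inner ℂ η (π g ξ - θ)‖ < ε

theorem InWeakOrbit.refl (π : UnitaryRep G H) (V : Subgroup G) (ξ : H) : InWeakOrbit π V ξ ξ :=
  fun E ε hε => ⟨1, V.one_mem, fun η _ => by simpa [rep_one_apply] using hε⟩

theorem InWeakOrbit.mono {π : UnitaryRep G H} {V W : Subgroup G} (hVW : V ≤ W) {ξ θ : H}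
    (h : InWeakOrbit π V ξ θ) : InWeakOrbit π W ξ θ := fun E ε hε => by
  obtain ⟨g, hg, h⟩ := h E ε hε
  exact ⟨g, hVW hg, h⟩

theorem InWeakOrbit.trans {π : UnitaryRep G H} {V : Subgroup G} {ξ θ κ : H}
    (h₁ : InWeakOrbit π V ξ θ) (h₂ : InWeakOrbit π V θ κ) : InWeakOrbit π V ξ κ := by
  classical
  intro E ε hε
  obtain ⟨g, hg, h⟩ := h₂ E (ε / 2) (half_pos hε)
  obtain ⟨k, hk, h'⟩ := h₁ (E.image fun η => π g⁻¹ η) (ε / 2) (half_pos hε)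
  refine ⟨g * k, V.mul_mem hg hk, fun η hη => ?_⟩
  have e : inner ℂ η (π (g * k) ξ - κ) =
      inner ℂ (π g⁻¹ η) (π k ξ - θ) + inner ℂ η (π g θ - κ) := by
    rw [← inner_rep_right, ← inner_add_right, map_sub, rep_mul_apply, sub_add_sub_cancel]
  rw [e]
  calc _ ≤ _ := norm_add_le _ _
    _ < ε / 2 + ε / 2 := add_lt_add (h' _ (Finset.mem_image_of_mem _ hη)) (h η hη)
    _ = ε := add_halves ε

theorem InWeakOrbit.inner_mem {π : UnitaryRep G H} {V : Subgroup G} {ξ θ : H}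
    (h : InWeakOrbit π V ξ θ) {η : H} {F : Set ℂ} (hF : F.Finite)
    (hη : ∀ g ∈ V, inner ℂ η (π g ξ) ∈ F) : inner ℂ η θ ∈ F := by
  rw [← hF.isClosed.closure_eq, Metric.mem_closure_iff]
  intro ε hε
  obtain ⟨g, hg, h'⟩ := h {η} ε hε
  refine ⟨_, hη g hg, ?_⟩
  rw [dist_comm, dist_eq_norm, ← inner_sub_right]
  exact h' η (Finset.mem_singleton_self η)

/-- A finite set of scalars is closed, so membership in `F` survives a weak limit, taken in one
argument and then in the other. -/
theorem InWeakOrbit.inner_mem_of_finite {π : UnitaryRep G H} {ξ θ κ : H} {F : Set ℂ}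
    (hF : F.Finite) (hξ : ∀ g : G, inner ℂ ξ (π g ξ) ∈ F)
    (hθ : InWeakOrbit π ⊤ ξ θ) (hκ : InWeakOrbit π ⊤ ξ κ) : inner ℂ θ κ ∈ F := by
  have h1 : ∀ g : G, inner ℂ (π g ξ) κ ∈ F := fun g =>
    hκ.inner_mem hF fun k _ => by
      rw [inner_rep_right, ← rep_mul_apply, ← inv_inv (k⁻¹ * g), ← inner_rep_right]
      exact hξ _
  have h2 : inner ℂ κ θ ∈ conj '' F :=
    hθ.inner_mem (hF.image _) fun g _ => ⟨_, h1 g, inner_conj_symm _ _⟩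
  obtain ⟨z, hz, h⟩ := h2
  rw [← inner_conj_symm, ← h, Complex.conj_conj]
  exact hz

/-- Banach-Alaoglu along an ultrafilter, moved to `H` by Riesz duality. -/
theorem exists_weak_limit [CompleteSpace H] (U : Ultrafilter H) (R : ℝ)
    (hU : Metric.closedBall (0 : H) R ∈ U) :
    ∃ θ : H, ∀ η : H, Tendsto (fun s : H => inner ℂ s η) U (𝓝 (inner ℂ θ η)) := by
  let f : H → WeakDual ℂ H := fun x => StrongDual.toWeakDual (InnerProductSpace.toDual ℂ H x)
  have hc := WeakDual.isCompact_closedBall (𝕜 := ℂ) (E := H) 0 R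
  have hmem : (WeakDual.toStrongDual ⁻¹' Metric.closedBall (0 : StrongDual ℂ H) R) ∈ U.map f := by
    refine Ultrafilter.mem_map.2 (Filter.mem_of_superset hU fun x hx => ?_)
    have hx' : ‖x‖ ≤ R := by simpa using hx
    change WeakDual.toStrongDual (f x) ∈ Metric.closedBall (0 : StrongDual ℂ H) R
    rw [mem_closedBall_zero_iff]
    exact ((InnerProductSpace.toDual ℂ H).norm_map x).trans_le hx'
  obtain ⟨φ, -, hφ⟩ := hc.ultrafilter_le_nhds (U.map f) (by simpa using hmem)
  refine ⟨(InnerProductSpace.toDual ℂ H).symm (WeakDual.toStrongDual φ), fun η => ?_⟩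
  rw [InnerProductSpace.toDual_symm_apply]
  have h1 : Tendsto (fun ψ : WeakDual ℂ H => ψ η) (𝓝 φ) (𝓝 (φ η)) :=
    (WeakDual.eval_continuous η).tendsto φ
  exact h1.comp (show Tendsto f U (𝓝 φ) from hφ)

theorem exists_lt_of_finite {S : Set ℝ} (hS : S.Finite) (a : ℝ) :
    ∃ c < a, ∀ x ∈ S, x < a → x ≤ c := by
  rcases Set.eq_empty_or_nonempty (S ∩ Set.Iio a) with h | h
  · refine ⟨a - 1, sub_one_lt a, fun x hx hxa => ?_⟩
    exact (Set.eq_empty_iff_forall_notMem.1 h x ⟨hx, hxa⟩).elim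
  · obtain ⟨c, hc, hmax⟩ := Set.exists_max_image _ id (hS.inter_of_left _) h
    exact ⟨c, hc.2, fun x hx hxa => hmax x ⟨hx, hxa⟩⟩

theorem inner_re_lt_of_ne {s t : H} (hst : s ≠ t) (hn : ‖s‖ = ‖t‖) :
    (inner ℂ s t).re < ‖t‖ ^ 2 := by
  have h1 : ‖s - t‖ ^ 2 = ‖s‖ ^ 2 - 2 * (inner ℂ s t).re + ‖t‖ ^ 2 := norm_sub_sq (𝕜 := ℂ) s t
  have h2 : 0 < ‖s - t‖ := norm_pos_iff.2 (sub_ne_zero.2 hst)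
  rw [hn] at h1
  nlinarith

/-- If all vectors with a finite `V`-orbit are fixed by `V`, then the projection onto the
`V`-fixed vectors maps a vector with finitely many matrix coefficients to a vector in the weak
closure of its `V`-orbit. -/
theorem inWeakOrbit_starProjection [CompleteSpace H] (π : UnitaryRep G H) (V : Subgroup G)
    (hV : ∀ θ : H, {κ | ∃ g ∈ V, π g θ = κ}.Finite → θ ∈ fixedVectors π V) (ζ : H)
    {F : Set ℂ} (hF : F.Finite)
    (hζ : ∀ θ κ : H, InWeakOrbit π V ζ θ → InWeakOrbit π V ζ κ → inner ℂ θ κ ∈ F) :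
    InWeakOrbit π V ζ ((fixedVectors π V).starProjection ζ) := by
  have hself : ∀ x : H, ‖x‖ ^ 2 = (inner ℂ x x).re := fun x => norm_sq_eq_re_inner (𝕜 := ℂ) x
  have hFre : (Complex.re '' F).Finite := hF.image _
  have hN : ((fun θ : H => ‖θ‖ ^ 2) '' {θ | InWeakOrbit π V ζ θ}).Finite := by
    refine hFre.subset ?_
    rintro _ ⟨θ, hθ, rfl⟩
    exact ⟨_, hζ θ θ hθ hθ, (hself θ).symm⟩
  -- A point of least norm in the weak closure exists because the squared norms take finitely many
  -- values.
  obtain ⟨_, ⟨θ, hθ : InWeakOrbit π V ζ θ, rfl⟩, hmin⟩ :=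
    Set.exists_min_image _ id hN ⟨_, ζ, InWeakOrbit.refl π V ζ, rfl⟩
  have hmin' : ∀ κ, InWeakOrbit π V ζ κ → ‖θ‖ ^ 2 ≤ ‖κ‖ ^ 2 := fun κ hκ => hmin _ ⟨κ, hκ, rfl⟩
  have horb : ∀ g ∈ V, InWeakOrbit π V ζ (π g θ) := fun g hg =>
    hθ.trans fun E ε hε => ⟨g, hg, fun η _ => by simpa using hε⟩
  have hθV : θ ∈ fixedVectors π V := by
    refine hV θ ?_
    by_contra hinf
    let O : Set H := {κ | ∃ g ∈ V, π g θ = κ}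
    have hO : O.Infinite := hinf
    have hOn : ∀ s ∈ O, ‖s‖ = ‖θ‖ := by
      rintro _ ⟨g, -, rfl⟩
      exact (π g).norm_map θ
    have hOW : ∀ s ∈ O, InWeakOrbit π V ζ s := by
      rintro _ ⟨g, hg, rfl⟩
      exact horb g hg
    -- Distinct vectors of `O` have an inner product with real part below `‖θ‖ ^ 2` and in a finite
    -- set, hence at most `c`. A weak limit `κ` of infinitely many of them then has `‖κ‖ ^ 2 ≤ c`,
    -- against minimality.
    obtain ⟨c, hc, hcle⟩ := exists_lt_of_finite hFre (‖θ‖ ^ 2)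
    have := hO.cofinite_inf_principal_neBot
    let U : Ultrafilter H := Ultrafilter.of (cofinite ⊓ 𝓟 O)
    have hU : (U : Filter H) ≤ cofinite ⊓ 𝓟 O := Ultrafilter.of_le _
    have hUO : ∀ᶠ s in (U : Filter H), s ∈ O := hU.trans inf_le_right (mem_principal_self O)
    obtain ⟨κ, hκ⟩ := exists_weak_limit U ‖θ‖
      (hUO.mono fun s hs => by simpa using (hOn s hs).le)
    have hκre : ∀ η, Tendsto (fun s : H => (inner ℂ s η).re) U (𝓝 (inner ℂ κ η).re) := fun η =>
      (Complex.continuous_re.tendsto _).comp (hκ η)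
    have h1 : ∀ s ∈ O, (inner ℂ κ s).re ≤ c := fun s hs => by
      refine le_of_tendsto (hκre s) ?_
      have hne : ∀ᶠ t in (U : Filter H), t ≠ s :=
        hU.trans inf_le_left ((Set.finite_singleton s).compl_mem_cofinite)
      filter_upwards [hne, hUO] with t ht htO
      refine hcle _ ⟨_, hζ t s (hOW t htO) (hOW s hs), rfl⟩ ?_
      have := inner_re_lt_of_ne ht ((hOn t htO).trans (hOn s hs).symm)
      rwa [hOn s hs] at this
    have h2 : ‖κ‖ ^ 2 ≤ c := by
      rw [hself]
      refine le_of_tendsto (hκre κ) (hUO.mono fun s hs => ?_)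
      have := h1 s hs
      rwa [← inner_conj_symm, Complex.conj_re] at this
    have h3 : InWeakOrbit π V ζ κ := by
      refine hθ.trans fun E ε hε => ?_
      have h4 : ∀ᶠ s in (U : Filter H), ∀ η ∈ E, ‖inner ℂ η (s - κ)‖ < ε := by
        rw [Filter.eventually_all_finset]
        intro η _
        filter_upwards [Metric.tendsto_nhds.1 (hκ η) ε hε] with s hs
        rwa [← inner_conj_symm, Complex.norm_conj, inner_sub_left, ← dist_eq_norm]
      obtain ⟨s, hs, ⟨g, hg, rfl⟩⟩ := (h4.and hUO).exists
      exact ⟨g, hg, hs⟩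
    exact absurd (h2.trans_lt hc) (not_lt.2 (hmin' κ h3))
  -- All `π g ζ` with `g ∈ V` have the same inner product with a `V`-fixed vector, and so does their
  -- weak limit `θ`.
  have hproj : (fixedVectors π V).starProjection ζ = θ := by
    refine (Submodule.eq_starProjection_of_mem_orthogonal hθV ?_)
    intro η hη
    rw [← norm_le_zero_iff]
    refine le_of_forall_pos_le_add fun ε hε => ?_
    obtain ⟨g, hg, h⟩ := hθ {η} ε hε
    have h' := h η (Finset.mem_singleton_self η)
    rw [inner_sub_right, inner_rep_right, hη g⁻¹ (V.inv_mem hg), ← inner_sub_right] at h'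
    simpa using h'.le
  rwa [hproj]

/-- The vector of least norm in the closed convex hull of the orbit `V ξ` is unique, hence fixed by
`V`, and the hull lies in the ball of radius `ε` about `ξ`. -/
theorem exists_fixedVector_near [CompleteSpace H] (π : UnitaryRep G H) (V : Subgroup G) (ξ : H)
    (ε : ℝ) (hξ : ∀ g ∈ V, ‖π g ξ - ξ‖ ≤ ε) : ∃ η ∈ fixedVectors π V, ‖η - ξ‖ ≤ ε := by
  let _ : InnerProductSpace ℝ H := InnerProductSpace.rclikeToReal ℂ H
  let O : Set H := {κ | ∃ g ∈ V, π g ξ = κ}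
  let K : Set H := closure (convexHull ℝ O)
  have hKconv : Convex ℝ K := (convex_convexHull ℝ O).closure
  have hsub : ∀ s : Set H, O ⊆ s → Convex ℝ s → IsClosed s → K ⊆ s := fun s h1 h2 h3 =>
    closure_minimal (convexHull_min h1 h2) h3
  have hne : K.Nonempty := ⟨ξ, subset_closure (subset_convexHull ℝ O
    ⟨1, V.one_mem, rep_one_apply π ξ⟩)⟩
  obtain ⟨η, hη, hmin⟩ := exists_norm_eq_iInf_of_complete_convex hne
    isClosed_closure.isComplete hKconv 0
  have hmin' : ∀ κ ∈ K, ‖η‖ ≤ ‖κ‖ := fun κ hκ => by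
    have : ‖(0 : H) - η‖ ≤ ‖(0 : H) - κ‖ := by
      rw [hmin]
      exact ciInf_le (f := fun w : K => ‖(0 : H) - w‖)
        ⟨0, Set.forall_mem_range.2 fun _ => norm_nonneg _⟩ ⟨κ, hκ⟩
    simpa using this
  refine ⟨η, fun g hg => ?_, ?_⟩
  · have hgη : π g η ∈ K := by
      refine hsub (π g ⁻¹' K) ?_ ?_ (isClosed_closure.preimage (π g).continuous) hη
      · rintro _ ⟨k, hk, rfl⟩
        exact subset_closure (subset_convexHull ℝ O ⟨g * k, V.mul_mem hg hk, rep_mul_apply π g k ξ⟩)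
      · exact hKconv.linear_preimage ((π g).toLinearEquiv.toLinearMap.restrictScalars ℝ)
    -- The midpoint of `η` and `π g η` is no shorter than `η`, so the parallelogram law forces the
    -- two to coincide.
    have hmid := hmin' _ (hKconv hgη hη (by norm_num : (0 : ℝ) ≤ 1 / 2)
      (by norm_num : (0 : ℝ) ≤ 1 / 2) (by norm_num))
    rw [← smul_add, norm_smul] at hmid
    have hpar := parallelogram_law_with_norm ℝ (π g η) η
    rw [(π g).norm_map] at hpar
    norm_num at hmid
    have h0 : ‖π g η - η‖ = 0 := by
      have := norm_nonneg (π g η - η)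
      have := norm_nonneg η
      nlinarith
    exact sub_eq_zero.1 (norm_eq_zero.1 h0)
  · have : K ⊆ Metric.closedBall ξ ε := by
      refine hsub _ ?_ (convex_closedBall ξ ε) Metric.isClosed_closedBall
      rintro _ ⟨g, hg, rfl⟩
      rw [mem_closedBall_iff_norm]
      exact hξ g hg
    rw [← mem_closedBall_iff_norm]
    exact this hη

end FixedVectors

/-! ### Commutation of projections by alternating iteration. -/

section CommutingProjections

variable {G : Type*} [Group G] {H : Type*} [NormedAddCommGroup H] [InnerProductSpace ℂ H]

theorem starProjection_eq_self_of_norm_le (S : Submodule ℂ H) [S.HasOrthogonalProjection] (x : H)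
    (h : ‖x‖ ≤ ‖S.starProjection x‖) : S.starProjection x = x := by
  rw [Submodule.starProjection_eq_self_iff, Submodule.mem_iff_norm_starProjection]
  exact le_antisymm (Submodule.norm_starProjection_apply_le S x) h

/-- If `V` and `W` fix every vector on which they have a finite orbit, then the projections onto
the `V`-fixed and the `W`-fixed vectors commute on vectors with finitely many matrix
coefficients. -/
theorem starProjection_mem_fixedVectors [CompleteSpace H] (π : UnitaryRep G H) (V W : Subgroup G)
    (hV : ∀ θ : H, {κ | ∃ g ∈ V, π g θ = κ}.Finite → θ ∈ fixedVectors π V)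
    (hW : ∀ θ : H, {κ | ∃ g ∈ W, π g θ = κ}.Finite → θ ∈ fixedVectors π W)
    (ξ : H) (hξV : ξ ∈ fixedVectors π V) {F : Set ℂ} (hF : F.Finite)
    (hξ : ∀ g : G, inner ℂ ξ (π g ξ) ∈ F) :
    (fixedVectors π W).starProjection ξ ∈ fixedVectors π V := by
  set P := (fixedVectors π V).starProjection with hP
  set Q := (fixedVectors π W).starProjection with hQ
  have hcl : ∀ (V' : Subgroup G),
      (∀ θ : H, {κ | ∃ g ∈ V', π g θ = κ}.Finite → θ ∈ fixedVectors π V') →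
      ∀ θ, InWeakOrbit π ⊤ ξ θ → InWeakOrbit π ⊤ ξ ((fixedVectors π V').starProjection θ) := by
    intro V' hV' θ hθ
    refine hθ.trans (InWeakOrbit.mono le_top (inWeakOrbit_starProjection π V' hV' θ hF ?_))
    intro α β hα hβ
    exact InWeakOrbit.inner_mem_of_finite hF hξ (hθ.trans (hα.mono le_top))
      (hθ.trans (hβ.mono le_top))
  -- Von Neumann's alternating projections. The iterates of `R` on `ξ` stay in the weak closure of
  -- the orbit, where norms take finitely many values, so the norm stops decreasing after finitely
  -- many steps.
  let R : H → H := fun x => P (Q (P x))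
  have hPle : ∀ x, ‖P x‖ ≤ ‖x‖ := Submodule.norm_starProjection_apply_le _
  have hQle : ∀ x, ‖Q x‖ ≤ ‖x‖ := Submodule.norm_starProjection_apply_le _
  have hRsub : ∀ x y, R (x - y) = R x - R y := fun x y => by simp [R]
  have hRsymm : ∀ x y, inner ℂ (R x) y = inner ℂ x (R y) := fun x y => by
    simp only [R, hP, hQ, Submodule.inner_starProjection_left_eq_right]
  have hRfix : ∀ x, ‖x‖ ≤ ‖R x‖ → P x = x ∧ Q x = x := by
    intro x hx
    have h1 : P x = x := starProjection_eq_self_of_norm_le _ x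
      (hx.trans ((hPle _).trans (hQle _)))
    refine ⟨h1, starProjection_eq_self_of_norm_le _ x (hx.trans ?_)⟩
    have h2 := hPle (Q (P x))
    change ‖P (Q (P x))‖ ≤ ‖Q x‖
    rw [h1] at h2 ⊢
    exact h2
  -- A self-adjoint operator has the same kernel as its powers. This brings the stabilization at
  -- step `k` back to `R (R ξ) = R ξ`.
  have hker : ∀ n x, R^[n + 1] x = 0 → R x = 0 := by
    intro n
    induction n with
    | zero => exact fun x h => h
    | succ n ih =>
      intro x h
      refine ih x ?_
      rw [Function.iterate_succ_apply'] at h ⊢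
      rw [Function.iterate_succ_apply'] at h
      rw [← inner_self_eq_zero (𝕜 := ℂ), hRsymm, h, inner_zero_right]
  have hmem : ∀ n, InWeakOrbit π ⊤ ξ (R^[n] ξ) := by
    intro n
    induction n with
    | zero => exact InWeakOrbit.refl π ⊤ ξ
    | succ n ih =>
      rw [Function.iterate_succ_apply']
      exact hcl V hV _ (hcl W hW _ (hcl V hV _ ih))
  obtain ⟨k, hk⟩ : ∃ k, ‖R^[k] ξ‖ ≤ ‖R (R^[k] ξ)‖ := by
    by_contra! hcon
    have hanti : StrictAnti fun k => ‖R^[k] ξ‖ ^ 2 := strictAnti_nat_of_succ_lt fun k => by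
      rw [Function.iterate_succ_apply']
      exact pow_lt_pow_left₀ (hcon k) (norm_nonneg _) two_ne_zero
    refine Set.infinite_range_of_injective hanti.injective ((hF.image Complex.re).subset ?_)
    rintro _ ⟨k, rfl⟩
    exact ⟨_, InWeakOrbit.inner_mem_of_finite hF hξ (hmem k) (hmem k),
      (norm_sq_eq_re_inner (𝕜 := ℂ) (R^[k] ξ)).symm⟩
  have hRR : R (R ξ) = R ξ := by
    obtain ⟨h1, h2⟩ := hRfix _ hk
    have h3 : R (R^[k] ξ) = R^[k] ξ := by
      change P (Q (P _)) = _
      rw [h1, h2, h1]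
    have hiter : ∀ n x y, R^[n] (x - y) = R^[n] x - R^[n] y := by
      intro n
      induction n with
      | zero => exact fun x y => rfl
      | succ n ih => intro x y; simp only [Function.iterate_succ_apply', ih, hRsub]
    have h4 : R^[k + 1] (R ξ - ξ) = 0 := by
      rw [hiter, ← Function.iterate_succ_apply, Function.iterate_succ_apply',
        Function.iterate_succ_apply', h3, h3, sub_self]
    have h5 := hker k _ h4
    rwa [hRsub, sub_eq_zero] at h5
  have hPξ : P ξ = ξ := Submodule.starProjection_eq_self_iff.2 hξV
  have hRξ : R ξ = P (Q ξ) := by change P (Q (P ξ)) = _; rw [hPξ]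
  -- Since `P ξ = ξ`, the number `⟨ξ, R ξ⟩` equals `‖Q ξ‖ ^ 2`, while `R (R ξ) = R ξ` makes it `‖P
  -- (Q ξ)‖ ^ 2`. So `P` does not shorten `Q ξ` and therefore fixes it.
  have h1 : (inner ℂ ξ (R ξ)) = (inner ℂ (Q ξ) (Q ξ) : ℂ) := by
    rw [hRξ, hP, ← Submodule.inner_starProjection_left_eq_right, ← hP, hPξ, hQ,
      Submodule.inner_starProjection_left_eq_right, ← hQ]
    congr 1
    exact (Submodule.starProjection_eq_self_iff.2 (Submodule.starProjection_apply_mem _ _)).symm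
  have h2 : (inner ℂ ξ (R ξ)) = (inner ℂ (R ξ) (R ξ) : ℂ) := by rw [hRsymm, hRR]
  have h3 : ‖Q ξ‖ ^ 2 = ‖P (Q ξ)‖ ^ 2 := by
    rw [← hRξ, norm_sq_eq_re_inner (𝕜 := ℂ), norm_sq_eq_re_inner (𝕜 := ℂ) (R ξ), ← h1, h2]
  have h4 : P (Q ξ) = Q ξ := starProjection_eq_self_of_norm_le _ _
    (le_of_eq ((sq_eq_sq₀ (norm_nonneg _) (norm_nonneg _)).1 h3))
  rw [← h4]
  exact Submodule.starProjection_apply_mem _ _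

end CommutingProjections

/-! ### Induced representations: vectors supported on one coset -/

section InducedDelta

variable {G : Type*} [Group G] {K : Type*} [NormedAddCommGroup K] [InnerProductSpace ℂ K]
  {S : Subgroup G} {σ : UnitaryRep S K}

theorem ind_apply (g : G) (f : IndSpace S σ) (x : G) : (ind S σ g f) x = f (g⁻¹ * x) := rfl

theorem IndSpace.add_apply (f₁ f₂ : IndSpace S σ) (x : G) : (f₁ + f₂) x = f₁ x + f₂ x := rfl

theorem IndSpace.smul_apply (c : ℂ) (f : IndSpace S σ) (x : G) : (c • f) x = c • f x := rfl

theorem IndSpace.inner_eq (f₁ f₂ : IndSpace S σ) :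
    inner ℂ f₁ f₂ = ∑' q : G ⧸ S, inner ℂ (f₁ q.out) (f₂ q.out) := rfl

theorem out_ne_of_ne {x : G} {q : G ⧸ S} (hq : q ≠ (x : G ⧸ S)) : x⁻¹ * q.out ∉ S := fun h =>
  hq (by rw [← QuotientGroup.out_eq' q]; exact (QuotientGroup.eq.2 h).symm)

open Classical in
theorem delta_mem (v : K) :
    (fun y : G => if hy : y ∈ S then σ ⟨y, hy⟩⁻¹ v else 0) ∈ indSubmodule S σ := by
  refine ⟨fun g k => ?_, ?_⟩
  · beta_reduce
    by_cases hg : g ∈ S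
    · have hgk : g * k ∈ S := S.mul_mem hg k.2
      have : (⟨g * k, hgk⟩ : S)⁻¹ = k⁻¹ * (⟨g, hg⟩ : S)⁻¹ := by
        rw [← mul_inv_rev]; rfl
      rw [dif_pos hgk, dif_pos hg, this, rep_mul_apply]
    · have hgk : g * k ∉ S := fun h => hg ((S.mul_mem_cancel_right k.2).1 h)
      rw [dif_neg hgk, dif_neg hg, map_zero]
  · refine summable_of_ne_finset_zero (s := {((1 : G) : G ⧸ S)}) fun q hq => ?_
    have hq' : q.out ∉ S := by simpa using out_ne_of_ne (by simpa using hq : q ≠ ((1 : G) : G ⧸ S))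
    simp [hq']

variable (S σ) in
open Classical in
/-- The function supported on the subgroup whose value at `1` is `v`. -/
noncomputable def indDelta (v : K) : IndSpace S σ := ⟨_, delta_mem (σ := σ) v⟩

theorem indDelta_apply_of_mem (v : K) {y : G} (hy : y ∈ S) :
    (indDelta S σ v) y = σ ⟨y, hy⟩⁻¹ v := dif_pos hy

theorem indDelta_apply_of_notMem (v : K) {y : G} (hy : y ∉ S) : (indDelta S σ v) y = 0 :=
  dif_neg hy

theorem indDelta_apply_one (v : K) : (indDelta S σ v) 1 = v := by
  rw [indDelta_apply_of_mem v S.one_mem]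
  exact (congrArg (fun k : S => σ k v) (inv_one (G := S))).trans (rep_one_apply σ v)

/-- The reproducing property: translates of `indDelta` represent the evaluations. It makes
evaluation continuous and the span of the translates dense. -/
theorem inner_ind_indDelta (x : G) (v : K) (f : IndSpace S σ) :
    inner ℂ (ind S σ x (indDelta S σ v)) f = inner ℂ v (f x) := by
  rw [IndSpace.inner_eq, tsum_eq_single (x : G ⧸ S)]
  · obtain ⟨k, hk⟩ := QuotientGroup.mk_out_eq_mul S x
    rw [hk, f.2.1 x k, ind_apply, inv_mul_cancel_left, indDelta_apply_of_mem v k.2]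
    exact (σ k⁻¹).inner_map_map _ _
  · intro q hq
    rw [ind_apply, indDelta_apply_of_notMem v (out_ne_of_ne hq), inner_zero_left]

variable (S σ) in
/-- `indDelta` as a linear isometry. -/
noncomputable def indDeltaIsometry : K →ₗᵢ[ℂ] IndSpace S σ where
  toFun := indDelta S σ
  map_add' v w := IndSpace.ext fun y => by
    rw [IndSpace.add_apply]
    by_cases hy : y ∈ S
    · simp only [indDelta_apply_of_mem _ hy, map_add]
    · simp only [indDelta_apply_of_notMem _ hy, add_zero]
  map_smul' c v := IndSpace.ext fun y => by
    rw [RingHom.id_apply, IndSpace.smul_apply]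
    by_cases hy : y ∈ S
    · simp only [indDelta_apply_of_mem _ hy, map_smul]
    · simp only [indDelta_apply_of_notMem _ hy, smul_zero]
  norm_map' v := by
    change ‖indDelta S σ v‖ = ‖v‖
    have h := inner_ind_indDelta 1 v (indDelta S σ v)
    rw [rep_one_apply, indDelta_apply_one] at h
    rw [← sq_eq_sq₀ (norm_nonneg _) (norm_nonneg _), norm_sq_eq_re_inner (𝕜 := ℂ), h,
      norm_sq_eq_re_inner (𝕜 := ℂ)]

theorem norm_indDelta (v : K) : ‖indDelta S σ v‖ = ‖v‖ := (indDeltaIsometry S σ).norm_map v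

theorem ind_indDelta (k : S) (v : K) :
    ind S σ (k : G) (indDelta S σ v) = indDelta S σ (σ k v) := IndSpace.ext fun y => by
  rw [ind_apply]
  by_cases hy : y ∈ S
  · have hky : (k : G)⁻¹ * y ∈ S := S.mul_mem (S.inv_mem k.2) hy
    rw [indDelta_apply_of_mem v hky, indDelta_apply_of_mem _ hy, ← rep_mul_apply]
    congr 2
    have : (⟨(k : G)⁻¹ * y, hky⟩ : S) = k⁻¹ * ⟨y, hy⟩ := rfl
    rw [this, mul_inv_rev, inv_inv]
  · have hky : (k : G)⁻¹ * y ∉ S := fun h => hy ((S.mul_mem_cancel_left (S.inv_mem k.2)).1 h)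
    rw [indDelta_apply_of_notMem v hky, indDelta_apply_of_notMem _ hy]

theorem eq_ind_indDelta (f : IndSpace S σ) (x : G) (hf : ∀ y, f y ≠ 0 → x⁻¹ * y ∈ S) :
    f = ind S σ x (indDelta S σ (f x)) := IndSpace.ext fun y => by
  rw [ind_apply]
  by_cases hy : x⁻¹ * y ∈ S
  · rw [indDelta_apply_of_mem _ hy, ← f.2.1 x ⟨_, hy⟩, mul_inv_cancel_left]
  · rw [indDelta_apply_of_notMem _ hy]
    by_contra hne
    exact hy (hf y hne)

theorem IndSpace.norm_apply_le (f : IndSpace S σ) (x : G) : ‖f x‖ ≤ ‖f‖ := by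
  have h := inner_ind_indDelta x (f x) f
  have h1 : ‖f x‖ ^ 2 ≤ ‖f x‖ * ‖f‖ := by
    rw [norm_sq_eq_re_inner (𝕜 := ℂ), ← h]
    refine (Complex.re_le_norm _).trans ((norm_inner_le_norm _ _).trans ?_)
    rw [LinearIsometryEquiv.norm_map, norm_indDelta]
  rcases (norm_nonneg (f x)).eq_or_lt with h0 | h0
  · rw [← h0]; exact norm_nonneg f
  · rw [sq] at h1
    exact le_of_mul_le_mul_left h1 h0

variable (S σ) in
/-- Evaluation at `x` on the space of the induced representation. -/
noncomputable def indEval (x : G) : IndSpace S σ →L[ℂ] K :=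
  LinearMap.mkContinuous
    { toFun := fun f => f x, map_add' := fun _ _ => rfl, map_smul' := fun _ _ => rfl } 1
    fun f => by
      rw [one_mul]
      exact f.norm_apply_le x

theorem eq_top_of_ind_indDelta_mem [CompleteSpace K] (W : Submodule ℂ (IndSpace S σ))
    (hW : IsClosed (W : Set (IndSpace S σ))) (h : ∀ x v, ind S σ x (indDelta S σ v) ∈ W) :
    W = ⊤ := by
  have := hW.completeSpace_coe
  rw [← Submodule.orthogonal_eq_bot_iff, Submodule.eq_bot_iff]
  intro f hf
  refine IndSpace.ext fun x => ?_
  have := hf _ (h x (f x))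
  rw [inner_ind_indDelta, inner_self_eq_zero] at this
  exact this

/-- A vector fixed by `V` is supported on cosets with a finite `V`-orbit. -/
theorem finite_orbit_of_apply_ne_zero {V : Subgroup G} {f : IndSpace S σ}
    (hf : f ∈ fixedVectors (ind S σ) V) {x : G} (hx : f x ≠ 0) :
    {q : G ⧸ S | ∃ g ∈ V, ((g * x : G) : G ⧸ S) = q}.Finite := by
  have hpos : 0 < ‖f x‖ ^ 2 := by positivity
  -- Norms of values of `f` are constant along `V`-orbits of cosets, and a summable family is
  -- bounded below by a positive constant only finitely often.
  have h := f.2.2.tendsto_cofinite_zero.eventually (gt_mem_nhds hpos)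
  refine (Filter.eventually_cofinite.1 h).subset ?_
  rintro _ ⟨g, hg, rfl⟩
  change ¬ ‖f (Quotient.out ((g * x : G) : G ⧸ S))‖ ^ 2 < ‖f x‖ ^ 2
  rw [f.norm_out, not_lt]
  have h1 : (ind S σ g f) (g * x) = f (g * x) := by rw [hf g hg]
  rw [ind_apply, inv_mul_cancel_left] at h1
  rw [h1]

end InducedDelta

/-! ### Irreducibility of induced representations and recognition of them. -/

section Irreducibility

variable {G : Type*} [Group G]

theorem orthogonal_invariant {H : Type*} [NormedAddCommGroup H] [InnerProductSpace ℂ H]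
    {π : UnitaryRep G H} {W : Submodule ℂ H} (hW : ∀ g : G, ∀ ξ ∈ W, π g ξ ∈ W) (g : G) {ξ : H}
    (hξ : ξ ∈ Wᗮ) : π g ξ ∈ Wᗮ := fun η hη => by
  rw [inner_rep_right]
  exact hξ _ (hW g⁻¹ η hη)

theorem starProjection_mem_fixedVectors_of_invariant {H : Type*} [NormedAddCommGroup H]
    [InnerProductSpace ℂ H] {π : UnitaryRep G H} {W : Submodule ℂ H} [W.HasOrthogonalProjection]
    (hW : ∀ g : G, ∀ ξ ∈ W, π g ξ ∈ W) {V : Subgroup G} {ξ : H} (hξ : ξ ∈ fixedVectors π V) :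
    W.starProjection ξ ∈ fixedVectors π V := fun g hg => by
  symm
  refine Submodule.eq_starProjection_of_mem_orthogonal
    (hW g _ (Submodule.starProjection_apply_mem _ _)) ?_
  have := orthogonal_invariant hW g (Submodule.sub_starProjection_mem_orthogonal (K := W) ξ)
  rwa [map_sub, hξ g hg] at this

theorem IsIrreducibleRep.of_equivalent {H₁ H₂ : Type*}
    [NormedAddCommGroup H₁] [InnerProductSpace ℂ H₁]
    [NormedAddCommGroup H₂] [InnerProductSpace ℂ H₂]
    {π₁ : UnitaryRep G H₁} {π₂ : UnitaryRep G H₂} (h₁ : IsIrreducibleRep π₁)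
    (h : UnitarilyEquivalent π₁ π₂) : IsIrreducibleRep π₂ := by
  obtain ⟨U, hU⟩ := h
  have := h₁.1
  refine ⟨U.symm.toEquiv.nontrivial, fun W hW hinv => ?_⟩
  have hmem : ∀ ξ : H₂, U.symm ξ ∈ W.comap U.toLinearEquiv.toLinearMap ↔ ξ ∈ W := fun ξ => by
    change U (U.symm ξ) ∈ W ↔ ξ ∈ W
    rw [U.apply_symm_apply]
  rcases h₁.2 (W.comap U.toLinearEquiv.toLinearMap) (hW.preimage U.continuous) fun g ξ hξ => by
      change U (π₁ g ξ) ∈ W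
      rw [hU]
      exact hinv g _ hξ with h | h
  · left
    rw [Submodule.eq_bot_iff]
    intro ξ hξ
    have h0 := (hmem ξ).2 hξ
    rw [h, Submodule.mem_bot] at h0
    simpa using h0
  · right
    rw [Submodule.eq_top_iff']
    intro ξ
    rw [← hmem, h]
    exact Submodule.mem_top

variable {K : Type*} [NormedAddCommGroup K] [InnerProductSpace ℂ K]
  {S : Subgroup G} {σ : UnitaryRep S K}

theorem eq_indDelta_of_fixed {V : Subgroup G}
    (hV : ∀ x : G, x ∉ S → ¬ {q : G ⧸ S | ∃ g ∈ V, ((g * x : G) : G ⧸ S) = q}.Finite)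
    {f : IndSpace S σ} (hf : f ∈ fixedVectors (ind S σ) V) : f = indDelta S σ (f 1) := by
  have h := eq_ind_indDelta f 1 fun y hy => by
    by_contra hyS
    exact hV y (by simpa using hyS) (finite_orbit_of_apply_ne_zero hf hy)
  rwa [rep_one_apply] at h

theorem indDelta_mem_fixedVectors {V : Subgroup G}
    (hV : ∀ g ∈ V, ∃ hg : g ∈ S, σ ⟨g, hg⟩ = 1) (v : K) :
    indDelta S σ v ∈ fixedVectors (ind S σ) V := fun g hg => by
  obtain ⟨hgS, h⟩ := hV g hg
  have := ind_indDelta (σ := σ) ⟨g, hgS⟩ v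
  rw [h] at this
  exact this

/-- Irreducibility criterion for induced representations. -/
theorem IsIrreducibleRep.ind [CompleteSpace K] (hσ : IsIrreducibleRep σ) (V : Subgroup G)
    (hVS : ∀ g ∈ V, ∃ hg : g ∈ S, σ ⟨g, hg⟩ = 1)
    (hV : ∀ x : G, x ∉ S → ¬ {q : G ⧸ S | ∃ g ∈ V, ((g * x : G) : G ⧸ S) = q}.Finite) :
    IsIrreducibleRep (ind S σ) := by
  have := hσ.1
  refine ⟨(indDeltaIsometry S σ).injective.nontrivial, fun W hW hinv => ?_⟩
  have := hW.completeSpace_coe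
  -- The `V`-fixed vectors are exactly the copy of `K` at the identity coset. By irreducibility of
  -- `σ`, `W` contains that copy or meets it in zero. In the second case the projection to `W`
  -- preserves `V`-fixedness, so it kills the copy, and `Wᗮ` is everything.
  rcases hσ.2 (W.comap (indDeltaIsometry S σ).toLinearMap)
    (hW.preimage (indDeltaIsometry S σ).continuous) fun k v hv => by
      change indDelta S σ (σ k v) ∈ W
      rw [← ind_indDelta]
      exact hinv _ _ hv with h | h
  · left
    have hperp : ∀ v, indDelta S σ v ∈ Wᗮ := fun v => by
      have h1 := starProjection_mem_fixedVectors_of_invariant hinv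
        (indDelta_mem_fixedVectors hVS v)
      have h2 := eq_indDelta_of_fixed hV h1
      have h3 : (W.starProjection (indDelta S σ v)) 1 ∈
          W.comap (indDeltaIsometry S σ).toLinearMap := by
        change indDelta S σ _ ∈ W
        rw [← h2]
        exact Submodule.starProjection_apply_mem _ _
      rw [h, Submodule.mem_bot] at h3
      rw [h3] at h2
      have h4 : indDelta S σ 0 = 0 := map_zero (indDeltaIsometry S σ)
      rw [h4] at h2
      exact (Submodule.starProjection_apply_eq_zero_iff W).1 h2
    have htop := eq_top_of_ind_indDelta_mem Wᗮ W.isClosed_orthogonal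
      fun x v => orthogonal_invariant hinv x (hperp v)
    exact (Submodule.orthogonal_eq_top_iff W).1 htop
  · right
    refine eq_top_of_ind_indDelta_mem W hW fun x v => hinv x _ ?_
    have : v ∈ W.comap (indDeltaIsometry S σ).toLinearMap := h ▸ Submodule.mem_top
    exact this

/-- An invariant subspace `W` of `K` induces the closed invariant subspace of functions with values
in `W`. -/
theorem IsIrreducibleRep.of_ind (h : IsIrreducibleRep (OmegaCat.ind S σ)) :
    IsIrreducibleRep σ := by
  have := h.1
  refine ⟨?_, fun W hW hinv => ?_⟩
  · obtain ⟨f, hf⟩ := exists_ne (0 : IndSpace S σ)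
    by_contra hK
    rw [not_nontrivial_iff_subsingleton] at hK
    exact hf (IndSpace.ext fun x => Subsingleton.elim _ _)
  · have hcl : IsClosed ((⨅ x : G, W.comap (indEval S σ x).toLinearMap :
        Submodule ℂ (IndSpace S σ)) : Set (IndSpace S σ)) := by
      rw [Submodule.coe_iInf]
      exact isClosed_iInter fun x => hW.preimage (indEval S σ x).continuous
    have hmem : ∀ f : IndSpace S σ, f ∈ (⨅ x : G, W.comap (indEval S σ x).toLinearMap :
        Submodule ℂ (IndSpace S σ)) ↔ ∀ x, f x ∈ W := fun f => by
      rw [Submodule.mem_iInf]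
      rfl
    rcases h.2 _ hcl fun g f hf => by
        rw [hmem] at hf ⊢
        exact fun x => hf (g⁻¹ * x) with h0 | h0
    · left
      rw [Submodule.eq_bot_iff]
      intro v hv
      have h1 : indDelta S σ v ∈ (⨅ x : G, W.comap (indEval S σ x).toLinearMap :
          Submodule ℂ (IndSpace S σ)) := by
        rw [hmem]
        intro x
        by_cases hx : x ∈ S
        · rw [indDelta_apply_of_mem v hx]
          exact hinv _ _ hv
        · rw [indDelta_apply_of_notMem v hx]
          exact W.zero_mem
      rw [h0, Submodule.mem_bot] at h1
      rw [← norm_eq_zero, ← norm_indDelta (S := S) (σ := σ), h1, norm_zero]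
    · right
      rw [Submodule.eq_top_iff']
      intro v
      have h1 : indDelta S σ v ∈ (⨅ x : G, W.comap (indEval S σ x).toLinearMap :
          Submodule ℂ (IndSpace S σ)) := h0 ▸ Submodule.mem_top
      have := (hmem _).1 h1 1
      rwa [indDelta_apply_one] at this

/-- An irreducible representation of `G` is induced from a representation of `S` if it contains
a copy of the latter whose translates by the cosets of `S` are pairwise orthogonal. -/
theorem equivalent_ind [CompleteSpace K] [Nontrivial K] {H : Type*} [NormedAddCommGroup H]
    [InnerProductSpace ℂ H] [CompleteSpace H] {π : UnitaryRep G H} (hπ : IsIrreducibleRep π)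
    (j : K →ₗᵢ[ℂ] H) (hj : ∀ k v, j (σ k v) = π k (j v))
    (horth : ∀ g ∉ S, ∀ v w, inner ℂ (j v) (π g (j w)) = 0) :
    UnitarilyEquivalent π (OmegaCat.ind S σ) := by
  let ι : G ⧸ S → K →ₗᵢ[ℂ] H := fun q => (π q.out).toLinearIsometry.comp j
  have hι : ∀ q (s : K), ι q s = π q.out (j s) := fun _ _ => rfl
  -- The orthogonal translates assemble into an isometry from the `ℓ²`-sum over cosets. It
  -- intertwines the actions because it does so on translates of `indDelta`, and its closed range is
  -- everything by irreducibility of `π`.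
  have hfam : OrthogonalFamily ℂ (fun _ : G ⧸ S => K) ι := by
    intro q q' hqq' s t
    rw [hι, hι, inner_rep_right, ← rep_mul_apply, ← inv_inv (_ * _), ← inner_rep_right]
    refine horth _ (fun hS => hqq' ?_) s t
    rw [← QuotientGroup.out_eq' q, ← QuotientGroup.out_eq' q']
    exact QuotientGroup.eq.2 (by simpa using hS)
  let e : IndSpace S σ →ₗᵢ[ℂ] lp (fun _ : G ⧸ S => K) 2 :=
    { (IndSpace.toLp S σ).toLinearMap with norm_map' := fun _ => rfl }
  let J : IndSpace S σ →ₗᵢ[ℂ] H := hfam.linearIsometry.comp e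
  have hJ : ∀ f : IndSpace S σ, HasSum (fun q : G ⧸ S => π q.out (j (f q.out))) (J f) :=
    fun f => hfam.hasSum_linearIsometry (e f)
  have hJδ : ∀ x v, J (OmegaCat.ind S σ x (indDelta S σ v)) = π x (j v) := by
    intro x v
    have h1 := hasSum_single (f := fun q : G ⧸ S =>
      π q.out (j ((OmegaCat.ind S σ x (indDelta S σ v)) q.out))) (x : G ⧸ S) (fun q hq => by
        rw [ind_apply, indDelta_apply_of_notMem v (out_ne_of_ne hq)]
        rw [map_zero, map_zero])
    rw [(hJ _).unique h1]
    obtain ⟨k, hk⟩ := QuotientGroup.mk_out_eq_mul S x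
    rw [hk, ind_apply, inv_mul_cancel_left, indDelta_apply_of_mem v k.2, hj, ← rep_mul_apply]
    congr 2
    simp
  have hJG : ∀ g f, J (OmegaCat.ind S σ g f) = π g (J f) := by
    let W : Submodule ℂ (IndSpace S σ) := ⨅ g : G,
      LinearMap.eqLocus (J.toLinearMap ∘ₗ (OmegaCat.ind S σ g).toLinearEquiv.toLinearMap)
        ((π g).toLinearEquiv.toLinearMap ∘ₗ J.toLinearMap)
    have hmem : ∀ f, f ∈ W ↔ ∀ g, J (OmegaCat.ind S σ g f) = π g (J f) := fun f => by
      rw [Submodule.mem_iInf]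
      rfl
    have hcl : IsClosed (W : Set (IndSpace S σ)) := by
      rw [Submodule.coe_iInf]
      exact isClosed_iInter fun g => isClosed_eq (J.continuous.comp (OmegaCat.ind S σ g).continuous)
        ((π g).continuous.comp J.continuous)
    have htop := eq_top_of_ind_indDelta_mem W hcl fun x v => by
      rw [hmem]
      intro g
      rw [← rep_mul_apply, hJδ, hJδ, rep_mul_apply]
    exact fun g f => (hmem f).1 (htop ▸ Submodule.mem_top) g
  have hsurj : Function.Surjective J := by
    rcases hπ.2 (LinearMap.range J.toLinearMap) (by
        rw [LinearMap.coe_range]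
        exact J.isometry.isClosedEmbedding.isClosed_range) (by
        rintro g _ ⟨f, rfl⟩
        exact ⟨OmegaCat.ind S σ g f, hJG g f⟩) with h | h
    · obtain ⟨v, hv⟩ := exists_ne (0 : K)
      have h1 : J (OmegaCat.ind S σ 1 (indDelta S σ v)) = j v := by
        rw [hJδ, rep_one_apply]
      have h2 : j v ∈ LinearMap.range J.toLinearMap := ⟨_, h1⟩
      rw [h, Submodule.mem_bot] at h2
      exact (hv (j.injective (h2.trans (map_zero j).symm))).elim
    · exact LinearMap.range_eq_top.1 h
  let U := LinearIsometryEquiv.ofSurjective J hsurj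
  refine ⟨U.symm, fun g ξ => ?_⟩
  rw [U.symm_apply_eq]
  change _ = J (OmegaCat.ind S σ g (U.symm ξ))
  rw [hJG]
  exact congrArg (π g) (U.apply_symm_apply ξ).symm

end Irreducibility

/-! ### Representations of automorphism groups -/

section AutTopology

open Topology

variable {L : FirstOrder.Language.{u, v}} {X : Type w} [L.Structure X]

theorem isOpen_setOf_apply_eq (x y : X) : IsOpen {g : X ≃[L] X | g x = y} := by
  let _ : TopologicalSpace X := ⊥
  have : DiscreteTopology X := ⟨rfl⟩
  refine isOpen_induced_iff.2 ⟨{f : X → X | f x = y}, ?_, rfl⟩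
  have hc : Continuous fun f : X → X => f x := continuous_apply x
  exact (isOpen_discrete ({y} : Set X)).preimage hc

theorem continuous_of_finite_support {Y : Type*} [TopologicalSpace Y] (φ : (X ≃[L] X) → Y)
    (C : Set X) (hC : C.Finite)
    (h : ∀ g g' : X ≃[L] X, (∀ c ∈ C, g c = g' c) → φ g = φ g') : Continuous φ := by
  rw [continuous_iff_continuousAt]
  intro g
  have hopen : IsOpen (⋂ c ∈ C, {g' : X ≃[L] X | g' c = g c}) :=
    hC.isOpen_biInter fun c _ => isOpen_setOf_apply_eq c (g c)
  have hmem : (⋂ c ∈ C, {g' : X ≃[L] X | g' c = g c}) ∈ 𝓝 g :=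
    hopen.mem_nhds (by simp)
  refine Filter.Tendsto.congr' (f₁ := fun _ => φ g) ?_ tendsto_const_nhds
  filter_upwards [hmem] with g' hg'
  exact (h g' g (by simpa using hg')).symm

theorem exists_fixingSubgroup_subset {U : Set (X ≃[L] X)} (hU : U ∈ 𝓝 (1 : X ≃[L] X)) :
    ∃ C : Set X, C.Finite ∧ ∀ g ∈ fixingSubgroup (X ≃[L] X) C, g ∈ U := by
  let _ : TopologicalSpace X := ⊥
  have : DiscreteTopology X := ⟨rfl⟩
  rw [nhds_induced, Filter.mem_comap] at hU
  obtain ⟨T, hT, hTU⟩ := hU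
  rw [nhds_pi, Filter.mem_pi] at hT
  obtain ⟨C, hC, t, ht, htT⟩ := hT
  refine ⟨C, hC, fun g hg => hTU (htT fun c hc => ?_)⟩
  have h1 : g c = c := (mem_fixingSubgroup_iff _).1 hg c hc
  change g c ∈ t c
  rw [h1]
  exact mem_of_mem_nhds (ht c)

end AutTopology

/-! ### Setwise and pointwise stabilizers of algebraically closed substructures. -/

section Stabilizers

variable {L : FirstOrder.Language.{u, v}} {X : Type w} [L.Structure X]

theorem mem_setStabilizer {A : L.Substructure X} {g : X ≃[L] X} :
    g ∈ setStabilizer A ↔ (g : X → X) '' (A : Set X) = A := Iff.rfl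

theorem restrictHom_apply (A : L.Substructure X) (g : setStabilizer A) (a : A) :
    ((restrictHom A g a : A) : X) = (g : X ≃[L] X) a := rfl

theorem image_eq_of_equiv {A B : L.Substructure X} (f : A ≃[L] B) (g : X ≃[L] X)
    (hg : ∀ a : A, g a = f a) : (g : X → X) '' (A : Set X) = B := by
  ext b
  constructor
  · rintro ⟨a, ha, rfl⟩
    rw [hg ⟨a, ha⟩]
    exact (f ⟨a, ha⟩).2
  · intro hb
    refine ⟨f.symm ⟨b, hb⟩, (f.symm ⟨b, hb⟩).2, ?_⟩
    rw [hg, FirstOrder.Language.Equiv.apply_symm_apply]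

theorem restrictHom_surjective (hhom : Homogeneous L X) (A : L.Substructure X) [Finite A] :
    Function.Surjective (restrictHom A) := fun f => by
  obtain ⟨g, hg⟩ := hhom A A inferInstance inferInstance f
  exact ⟨⟨g, image_eq_of_equiv f g hg⟩,
    FirstOrder.Language.Equiv.ext fun a => Subtype.ext (hg a)⟩

theorem fixingSubgroup_le_ker (A : L.Substructure X) {K : Type*} [NormedAddCommGroup K]
    [InnerProductSpace ℂ K] (σ : UnitaryRep (A ≃[L] A) K) :
    ∀ g ∈ fixingSubgroup (X ≃[L] X) (A : Set X),
      ∃ hg : g ∈ setStabilizer A, σ.comp (restrictHom A) ⟨g, hg⟩ = 1 := by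
  intro g hg
  rw [mem_fixingSubgroup_iff] at hg
  have h1 : (g : X → X) '' (A : Set X) = A := by
    conv_rhs => rw [← Set.image_id (A : Set X)]
    exact Set.image_congr hg
  refine ⟨h1, ?_⟩
  have h2 : restrictHom A ⟨g, h1⟩ = 1 :=
    FirstOrder.Language.Equiv.ext fun a => Subtype.ext (hg a a.2)
  rw [MonoidHom.comp_apply, h2, map_one]

/-- A coset `y G_B` determines the finite set `y B`. If the coset of `x` has a finite orbit under
the fixer of `A`, then `x b` moves within a finite union of such sets, so it is algebraic over `A`.
-/
theorem apply_mem_of_finite_orbit {A B : L.Substructure X} [Finite B]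
    (hA : AlgebraicallyClosed A) {x : X ≃[L] X}
    (hx : {q : (X ≃[L] X) ⧸ setStabilizer B | ∃ g ∈ fixingSubgroup (X ≃[L] X) (A : Set X),
      ((g * x : X ≃[L] X) : (X ≃[L] X) ⧸ setStabilizer B) = q}.Finite) :
    ∀ b ∈ B, x b ∈ A := by
  intro b hb
  refine hA (x b) ?_
  refine (hx.biUnion fun q _ =>
    (Set.toFinite (B : Set X)).image (q.out : X → X)).subset ?_
  rintro _ ⟨g, hg, rfl⟩
  refine Set.mem_biUnion (x := ((g * x : X ≃[L] X) : (X ≃[L] X) ⧸ setStabilizer B))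
    ⟨g, (mem_fixingSubgroup_iff _).2 hg, rfl⟩ ?_
  obtain ⟨k, hk⟩ := QuotientGroup.mk_out_eq_mul (setStabilizer B) (g * x)
  rw [hk]
  refine ⟨(k⁻¹ : setStabilizer B) • b, setStabilizer_apply_mem k⁻¹ ⟨b, hb⟩, ?_⟩
  change (g * x * k) • ((k⁻¹ : setStabilizer B) : X ≃[L] X) • b = _
  rw [← mul_smul, Subgroup.coe_inv, mul_inv_cancel_right]
  rfl

theorem image_eq_of_forall_mem {A B : L.Substructure X} [Finite A] [Finite B] {x : X ≃[L] X}
    (hx : ∀ b ∈ B, x b ∈ A) (hcard : Nat.card A ≤ Nat.card B) : (x : X → X) '' (B : Set X) = A := by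
  refine Set.eq_of_subset_of_ncard_le (Set.image_subset_iff.2 hx) ?_ (Set.toFinite (A : Set X))
  rw [Set.ncard_image_of_injective _ x.injective]
  exact hcard

theorem card_le_of_forall_mem {A B : L.Substructure X} [Finite A] {x : X ≃[L] X}
    (hx : ∀ b ∈ B, x b ∈ A) : Nat.card B ≤ Nat.card A :=
  Nat.card_le_card_of_injective (fun b : B => (⟨x b, hx b b.2⟩ : A)) fun _ _ hbc =>
    Subtype.ext (x.injective (congrArg Subtype.val hbc))

theorem not_finite_orbit {A : L.Substructure X} [Finite A] (hA : AlgebraicallyClosed A)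
    (x : X ≃[L] X) (hx : x ∉ setStabilizer A) :
    ¬ {q : (X ≃[L] X) ⧸ setStabilizer A | ∃ g ∈ fixingSubgroup (X ≃[L] X) (A : Set X),
      ((g * x : X ≃[L] X) : (X ≃[L] X) ⧸ setStabilizer A) = q}.Finite := fun h =>
  hx (image_eq_of_forall_mem (apply_mem_of_finite_orbit hA h) le_rfl)

theorem AlgebraicallyClosed.map {A : L.Substructure X} (hA : AlgebraicallyClosed A)
    (g : X ≃[L] X) : AlgebraicallyClosed (A.map g.toHom) := by
  intro b hb
  have h : g.symm b ∈ A := by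
    refine hA _ ((hb.image g.symm).subset ?_)
    rintro _ ⟨k, hk, rfl⟩
    refine ⟨g (k (g.symm b)), ⟨g * k * g⁻¹, ?_, rfl⟩, g.symm_apply_apply _⟩
    rintro _ ⟨a, ha, rfl⟩
    change g (k (g.symm (g a))) = g a
    rw [g.symm_apply_apply, hk a ha]
  exact ⟨_, h, g.apply_symm_apply b⟩

theorem AlgebraicallyClosed.inf {A B : L.Substructure X} (hA : AlgebraicallyClosed A)
    (hB : AlgebraicallyClosed B) : AlgebraicallyClosed (A ⊓ B) := by
  intro b hb
  refine ⟨hA b (hb.subset ?_), hB b (hb.subset ?_)⟩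
  · rintro _ ⟨g, hg, rfl⟩
    exact ⟨g, fun a ha => hg a ha.1, rfl⟩
  · rintro _ ⟨g, hg, rfl⟩
    exact ⟨g, fun a ha => hg a ha.2, rfl⟩

end Stabilizers

/-! ### The representations induced from stabilizers are continuous and irreducible. -/

section InducedFromStabilizers

variable {L : FirstOrder.Language.{u, v}} {X : Type w} [L.Structure X]

theorem IsIrreducibleRep.comp_surjective {G₁ G₂ : Type*} [Group G₁] [Group G₂] {K : Type*}
    [NormedAddCommGroup K] [InnerProductSpace ℂ K] {σ : UnitaryRep G₂ K} (hσ : IsIrreducibleRep σ)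
    {f : G₁ →* G₂} (hf : Function.Surjective f) : IsIrreducibleRep (σ.comp f) := by
  refine ⟨hσ.1, fun W hW hinv => hσ.2 W hW fun g ξ hξ => ?_⟩
  obtain ⟨k, rfl⟩ := hf g
  exact hinv k ξ hξ

theorem IsIrreducibleRep.of_comp {G₁ G₂ : Type*} [Group G₁] [Group G₂] {K : Type*}
    [NormedAddCommGroup K] [InnerProductSpace ℂ K] {σ : UnitaryRep G₂ K}
    {f : G₁ →* G₂} (hσ : IsIrreducibleRep (σ.comp f)) : IsIrreducibleRep σ :=
  ⟨hσ.1, fun W hW hinv => hσ.2 W hW fun g ξ hξ => hinv (f g) ξ hξ⟩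

/-- The orbit map of the translate of `indDelta` by `x` depends only on the action on the finite set
`x A`, hence is locally constant. Vectors with a continuous orbit map form a closed subspace, by
uniform convergence. -/
theorem stronglyContinuous_indAut (A : L.Substructure X) [Finite A] {K : Type*}
    [NormedAddCommGroup K] [InnerProductSpace ℂ K] [CompleteSpace K]
    (σ : UnitaryRep (A ≃[L] A) K) : StronglyContinuous (indAut A σ) := by
  let W : Submodule ℂ (IndSpace (setStabilizer A) (σ.comp (restrictHom A))) :=
    { carrier := {f | Continuous fun g : X ≃[L] X => indAut A σ g f}
      add_mem' := fun {a b} ha hb => by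
        simp only [Set.mem_ofPred_eq, map_add] at ha hb ⊢
        exact ha.add hb
      zero_mem' := by
        simp only [Set.mem_ofPred_eq, map_zero]
        exact continuous_const
      smul_mem' := fun c a ha => by
        simp only [Set.mem_ofPred_eq, map_smul] at ha ⊢
        exact ha.const_smul c }
  have hmem : ∀ f, f ∈ W ↔ Continuous fun g : X ≃[L] X => indAut A σ g f := fun f => Iff.rfl
  have hcl : IsClosed (W : Set (IndSpace (setStabilizer A) (σ.comp (restrictHom A)))) := by
    rw [← isSeqClosed_iff_isClosed]
    intro s f hs hf
    refine TendstoUniformly.continuous (F := fun n (g : X ≃[L] X) => indAut A σ g (s n))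
      (p := Filter.atTop) ?_ (Filter.Frequently.of_forall fun n => hs n)
    rw [Metric.tendstoUniformly_iff]
    intro ε hε
    filter_upwards [Metric.tendsto_nhds.1 hf ε hε] with n hn g
    rw [(indAut A σ g).dist_map, dist_comm]
    exact hn
  have htop := eq_top_of_ind_indDelta_mem W hcl fun x v => by
    rw [hmem]
    refine continuous_of_finite_support _ ((x : X → X) '' (A : Set X))
      ((Set.toFinite (A : Set X)).image _) fun g g' hgg' => ?_
    rw [← rep_mul_apply, ← rep_mul_apply]
    have hk : (g' * x)⁻¹ * (g * x) ∈ fixingSubgroup (X ≃[L] X) (A : Set X) := by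
      rw [mem_fixingSubgroup_iff]
      intro a ha
      rw [mul_smul, inv_smul_eq_iff]
      exact hgg' _ ⟨a, ha, rfl⟩
    have h1 := indDelta_mem_fixedVectors (fixingSubgroup_le_ker A σ) v _ hk
    rw [← mul_inv_cancel_left (g' * x) (g * x), rep_mul_apply, h1]
  exact fun f => (hmem f).1 (htop ▸ Submodule.mem_top)

theorem isIrreducibleRep_indAut (hhom : Homogeneous L X) (A : L.Substructure X) [Finite A]
    (hA : AlgebraicallyClosed A) {K : Type*} [NormedAddCommGroup K] [InnerProductSpace ℂ K]
    [CompleteSpace K] (σ : UnitaryRep (A ≃[L] A) K) (hσ : IsIrreducibleRep σ) :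
    IsIrreducibleRep (indAut A σ) :=
  (hσ.comp_surjective (restrictHom_surjective hhom A)).ind
    (fixingSubgroup (X ≃[L] X) (A : Set X)) (fixingSubgroup_le_ker A σ) (not_finite_orbit hA)

end InducedFromStabilizers

/-! ### Every irreducible representation is induced. -/

section Classification

open Topology

variable {L : FirstOrder.Language.{u, v}} {X : Type w} [L.Structure X]

/-- A vector with a finite orbit under the pointwise stabilizer of an algebraically closed
substructure is fixed by it. -/
theorem mem_fixedVectors_of_finite_orbit [Countable L.Symbols] (hcat : OmegaCategorical L X)
    (hhom : Homogeneous L X) (hwei : WeakElimination L X) {H : Type*} [NormedAddCommGroup H]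
    [InnerProductSpace ℂ H] {π : UnitaryRep (X ≃[L] X) H} (hπ : StronglyContinuous π)
    (A : L.Substructure X) [Finite A] (hA : AlgebraicallyClosed A) (θ : H)
    (hθ : {κ | ∃ g ∈ fixingSubgroup (X ≃[L] X) (A : Set X), π g θ = κ}.Finite) :
    θ ∈ fixedVectors π (fixingSubgroup (X ≃[L] X) (A : Set X)) := by
  let _ : MulAction (X ≃[L] X) H :=
    { smul := fun g ξ => π g ξ
      one_smul := rep_one_apply π
      mul_smul := rep_mul_apply π }
  -- In a finite orbit `θ` is isolated, so an element that fixes `A` and is close to the identity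
  -- fixes `θ`. Hence the stabilizer of `θ` contains the fixer of a finite set and has a support,
  -- which lies in `A`.
  have hU : {g : X ≃[L] X | π g θ ∈
      ({κ | ∃ g ∈ fixingSubgroup (X ≃[L] X) (A : Set X), π g θ = κ} \ {θ})ᶜ} ∈
        𝓝 (1 : X ≃[L] X) := by
    refine (hπ θ).continuousAt.preimage_mem_nhds ?_
    rw [rep_one_apply]
    exact hθ.sdiff.isClosed.isOpen_compl.mem_nhds (by simp)
  obtain ⟨C, hC, hCU⟩ := exists_fixingSubgroup_subset hU
  obtain ⟨D, hD, hDA⟩ := exists_finite_support hcat hhom hwei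
    (MulAction.stabilizer (X ≃[L] X) θ) (A ∪ C) ((Set.toFinite (A : Set X)).union hC) (by
      intro g hg
      rw [mem_fixingSubgroup_iff] at hg
      have h1 := hCU g ((mem_fixingSubgroup_iff _).2 fun c hc => hg c (Or.inr hc))
      by_contra hne
      exact h1 ⟨⟨g, (mem_fixingSubgroup_iff _).2 fun a ha => hg a (Or.inl ha), rfl⟩, hne⟩)
  have hDA' := hDA A hA ((finite_orbit_iff _ θ).1 hθ)
  intro g hg
  exact hD (fixingSubgroup_antitone (X ≃[L] X) X hDA' hg)

/-- The coefficient `⟨ξ, π g ξ⟩` depends only on the orbit of the pair of tuples `(A, g A)`, and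
there are finitely many orbits of such pairs. -/
theorem finite_inner_of_fixed [Countable L.Symbols] (hcat : OmegaCategorical L X)
    (hhom : Homogeneous L X) {H : Type*} [NormedAddCommGroup H]
    [InnerProductSpace ℂ H] (π : UnitaryRep (X ≃[L] X) H) (A : L.Substructure X) [Finite A]
    (ξ : H) (hξ : ξ ∈ fixedVectors π (fixingSubgroup (X ≃[L] X) (A : Set X))) :
    (Set.range fun g : X ≃[L] X => (inner ℂ ξ (π g ξ) : ℂ)).Finite := by
  obtain ⟨T, hT, hcov⟩ := exists_finite_orbit_representatives hcat hhom (A ⊕ A)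
  have hsub : (Set.range fun g : X ≃[L] X => (inner ℂ ξ (π g ξ) : ℂ)) ⊆
      ⋃ t ∈ T, {z | ∃ g k : X ≃[L] X,
        (∀ i, k (t i) = Sum.elim (fun a : A => (a : X)) (fun a : A => g a) i) ∧
          inner ℂ ξ (π g ξ) = z} := by
    rintro _ ⟨g, rfl⟩
    obtain ⟨t, ht, k, hk⟩ := hcov (Sum.elim (fun a : A => (a : X)) fun a : A => g a)
    exact Set.mem_biUnion ht ⟨g, k, hk, rfl⟩
  refine (hT.biUnion fun t _ => Set.Subsingleton.finite ?_).subset hsub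
  rintro _ ⟨g, k, hk, rfl⟩ _ ⟨g', k', hk', rfl⟩
  have hm : ∀ i, (k' * k⁻¹) • Sum.elim (fun a : A => (a : X)) (fun a : A => g a) i =
      Sum.elim (fun a : A => (a : X)) (fun a : A => g' a) i := fun i => by
    rw [mul_smul, ← hk, ← hk']
    congr 1
    exact inv_smul_smul k (t i)
  have h1 : k' * k⁻¹ ∈ fixingSubgroup (X ≃[L] X) (A : Set X) :=
    (mem_fixingSubgroup_iff _).2 fun a ha => hm (Sum.inl ⟨a, ha⟩)
  have h2 : g'⁻¹ * (k' * k⁻¹ * g) ∈ fixingSubgroup (X ≃[L] X) (A : Set X) := by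
    refine (mem_fixingSubgroup_iff _).2 fun a ha => ?_
    rw [mul_smul, inv_smul_eq_iff, mul_smul]
    exact hm (Sum.inr ⟨a, ha⟩)
  have h3 := hξ _ h2
  rw [rep_mul_apply] at h3
  have h4 : π g' ξ = π (k' * k⁻¹) (π g ξ) := by
    rw [← rep_mul_apply, ← rep_apply_inv_self π g' (π (k' * k⁻¹ * g) ξ), h3]
  rw [h4, inner_rep_right π (k' * k⁻¹), hξ _ (inv_mem h1)]

/-- The stabilizer of `θ` has a support contained in `A` as well as in `B`. This replaces any claim
that the two fixers generate the fixer of the intersection. -/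
theorem mem_fixedVectors_inf [Countable L.Symbols] (hcat : OmegaCategorical L X)
    (hhom : Homogeneous L X) (hwei : WeakElimination L X) {H : Type*} [NormedAddCommGroup H]
    [InnerProductSpace ℂ H] {π : UnitaryRep (X ≃[L] X) H}
    {A B : L.Substructure X} [Finite A] (hA : AlgebraicallyClosed A)
    (hB : AlgebraicallyClosed B) {θ : H}
    (hθA : θ ∈ fixedVectors π (fixingSubgroup (X ≃[L] X) (A : Set X)))
    (hθB : θ ∈ fixedVectors π (fixingSubgroup (X ≃[L] X) (B : Set X))) :
    θ ∈ fixedVectors π (fixingSubgroup (X ≃[L] X) ((A ⊓ B : L.Substructure X) : Set X)) := by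
  let W : Subgroup (X ≃[L] X) :=
    { carrier := {g | π g θ = θ}
      mul_mem' := fun {g k} hg hk => by
        simp only [Set.mem_ofPred_eq] at hg hk ⊢
        rw [rep_mul_apply, hk, hg]
      one_mem' := rep_one_apply π θ
      inv_mem' := fun {g} hg => by
        simp only [Set.mem_ofPred_eq] at hg ⊢
        conv_lhs => rw [← hg]
        exact rep_inv_apply_self π g θ }
  have hAW : fixingSubgroup (X ≃[L] X) (A : Set X) ≤ W := hθA
  have hBW : fixingSubgroup (X ≃[L] X) (B : Set X) ≤ W := hθB
  obtain ⟨D, hD, hDA⟩ := exists_finite_support hcat hhom hwei W A (Set.toFinite (A : Set X)) hAW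
  have h1 := hDA A hA (by rw [Subgroup.relIndex_eq_one.2 hAW]; exact one_ne_zero)
  have h2 := hDA B hB (by rw [Subgroup.relIndex_eq_one.2 hBW]; exact one_ne_zero)
  intro g hg
  exact hD (fixingSubgroup_antitone (X ≃[L] X) X (Set.subset_inter h1 h2) hg)

theorem map_mem_fixedVectors_map {H : Type*} [NormedAddCommGroup H]
    [InnerProductSpace ℂ H] {π : UnitaryRep (X ≃[L] X) H} {A : L.Substructure X}
    (g : X ≃[L] X) {ξ : H} (hξ : ξ ∈ fixedVectors π (fixingSubgroup (X ≃[L] X) (A : Set X))) :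
    π g ξ ∈ fixedVectors π (fixingSubgroup (X ≃[L] X) (A.map g.toHom : Set X)) := by
  intro k hk
  rw [mem_fixingSubgroup_iff] at hk
  have h1 : g⁻¹ * (k * g) ∈ fixingSubgroup (X ≃[L] X) (A : Set X) := by
    refine (mem_fixingSubgroup_iff _).2 fun a ha => ?_
    rw [mul_smul, inv_smul_eq_iff, mul_smul]
    exact hk _ ⟨a, ha, rfl⟩
  have h2 := congrArg (π g) (hξ _ h1)
  rwa [← rep_mul_apply, mul_inv_cancel_left, rep_mul_apply] at h2

/-- The representation of the automorphism group of `A` on the vectors fixed by the pointwise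
stabilizer of `A`. -/
theorem exists_rep_fixedVectors (hhom : Homogeneous L X) {H : Type*} [NormedAddCommGroup H]
    [InnerProductSpace ℂ H] (π : UnitaryRep (X ≃[L] X) H) (A : L.Substructure X) [Finite A] :
    ∃ σ : UnitaryRep (A ≃[L] A)
        (fixedVectors π (fixingSubgroup (X ≃[L] X) (A : Set X))),
      ∀ (k : setStabilizer A) (ξ : fixedVectors π (fixingSubgroup (X ≃[L] X) (A : Set X))),
        (σ.comp (restrictHom A) k ξ : H) = π k ξ := by
  have hinv : ∀ (k : setStabilizer A), ∀ ξ ∈ fixedVectors π (fixingSubgroup (X ≃[L] X) (A : Set X)),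
      π k ξ ∈ fixedVectors π (fixingSubgroup (X ≃[L] X) (A : Set X)) := fun k ξ hξ => by
    have h1 := map_mem_fixedVectors_map (k : X ≃[L] X) hξ
    have h2 : (A.map (k : X ≃[L] X).toHom : Set X) = A := k.2
    rwa [h2] at h1
  let ρ : UnitaryRep (setStabilizer A)
      (fixedVectors π (fixingSubgroup (X ≃[L] X) (A : Set X))) :=
    { toFun := fun k =>
        { toFun := fun ξ => ⟨π k ξ, hinv k ξ ξ.2⟩
          invFun := fun ξ => ⟨π ((k⁻¹ : setStabilizer A) : X ≃[L] X) ξ, hinv k⁻¹ ξ ξ.2⟩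
          left_inv := fun ξ => Subtype.ext (rep_inv_apply_self π _ _)
          right_inv := fun ξ => Subtype.ext (rep_apply_inv_self π _ _)
          map_add' := fun ξ η => Subtype.ext (map_add (π k) _ _)
          map_smul' := fun c ξ => Subtype.ext (map_smul (π k) c _)
          norm_map' := fun ξ => (π k).norm_map _ }
      map_one' := LinearIsometryEquiv.ext fun ξ => Subtype.ext (rep_one_apply π _)
      map_mul' := fun k l => LinearIsometryEquiv.ext fun ξ => Subtype.ext (rep_mul_apply π _ _ _) }
  -- An element acting trivially on `A` fixes these vectors, so `ρ` descends along the restriction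
  -- homomorphism, which is onto by homogeneity.
  have hker : (restrictHom A).ker ≤ ρ.ker := fun k hk => by
    rw [MonoidHom.mem_ker] at hk ⊢
    refine LinearIsometryEquiv.ext fun ξ => Subtype.ext (ξ.2 k ?_)
    refine (mem_fixingSubgroup_iff _).2 fun a ha => ?_
    exact congrArg Subtype.val (DFunLike.congr_fun hk (⟨a, ha⟩ : A))
  refine ⟨(restrictHom A).liftOfSurjective (restrictHom_surjective hhom A) ⟨ρ, hker⟩,
    fun k ξ => ?_⟩
  have := (restrictHom A).liftOfRightInverse_comp_apply _
    (Function.rightInverse_surjInv (restrictHom_surjective hhom A)) ⟨ρ, hker⟩ k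
  exact congrArg Subtype.val (DFunLike.congr_fun this ξ)

/-- Every irreducible representation is induced. -/
theorem exists_equivalent_indAut [Countable L.Symbols] (hcat : OmegaCategorical L X)
    (hhom : Homogeneous L X) (hwei : WeakElimination L X) {H : Type*} [NormedAddCommGroup H]
    [InnerProductSpace ℂ H] [CompleteSpace H] (π : UnitaryRep (X ≃[L] X) H)
    (hπ : StronglyContinuous π) (hirr : IsIrreducibleRep π) :
    ∃ A : L.Substructure X, Finite A ∧ AlgebraicallyClosed A ∧
      ∃ σ : UnitaryRep (A ≃[L] A) (fixedVectors π (fixingSubgroup (X ≃[L] X) (A : Set X))),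
        IsIrreducibleRep σ ∧ UnitarilyEquivalent π (indAut A σ) := by
  have := hirr.1
  let P : L.Substructure X → Prop := fun A => Finite A ∧ AlgebraicallyClosed A ∧
    fixedVectors π (fixingSubgroup (X ≃[L] X) (A : Set X)) ≠ ⊥
  have hex : ∃ A, P A := by
    obtain ⟨ξ, hξ⟩ := exists_ne (0 : H)
    have hpos : 0 < ‖ξ‖ := norm_pos_iff.2 hξ
    have hU : {g : X ≃[L] X | π g ξ ∈ Metric.ball ξ (‖ξ‖ / 2)} ∈ 𝓝 (1 : X ≃[L] X) := by
      refine (hπ ξ).continuousAt.preimage_mem_nhds ?_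
      rw [rep_one_apply]
      exact Metric.ball_mem_nhds ξ (half_pos hpos)
    obtain ⟨C, hC, hCU⟩ := exists_fixingSubgroup_subset hU
    obtain ⟨η, hη, hηξ⟩ := exists_fixedVector_near π (fixingSubgroup (X ≃[L] X) C) ξ (‖ξ‖ / 2)
      fun g hg => (mem_ball_iff_norm.1 (hCU g hg)).le
    obtain ⟨A, hAf, hA, hCA⟩ := exists_algebraicallyClosed hcat hhom C hC
    refine ⟨A, hAf, hA, (Submodule.ne_bot_iff _).2
      ⟨η, fun g hg => hη g (fixingSubgroup_antitone (X ≃[L] X) X hCA hg), ?_⟩⟩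
    rintro rfl
    rw [zero_sub, norm_neg] at hηξ
    linarith
  -- An `A` of least size carrying fixed vectors: nothing is fixed by the fixer of a smaller
  -- algebraically closed set, such as `A ⊓ g A` when `g A ≠ A`.
  obtain ⟨A, ⟨hAf, hA, hne⟩, hmin⟩ :=
    WellFounded.has_min (InvImage.wf (fun A : L.Substructure X => Nat.card A) Nat.lt_wfRel.wf)
      {A | P A} hex
  have hmin' : ∀ B, P B → Nat.card A ≤ Nat.card B := fun B hB => not_lt.1 (hmin B hB)
  obtain ⟨σ, hσ⟩ := exists_rep_fixedVectors hhom π A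
  refine ⟨A, hAf, hA, σ, ?_⟩
  have := Submodule.nontrivial_iff_ne_bot.2 hne
  have horth : ∀ g ∉ setStabilizer A, ∀ ξ η :
      fixedVectors π (fixingSubgroup (X ≃[L] X) (A : Set X)),
        inner ℂ (ξ : H) (π g (η : H)) = 0 := by
    intro g hg ξ η
    let B := A.map g.toHom
    have hBf : Finite B := ((Set.toFinite (A : Set X)).image (g : X → X)).to_subtype
    have hB : AlgebraicallyClosed B := hA.map g
    -- The projection of `ξ` is fixed by both fixers, hence by that of `A ⊓ B`; minimality then
    -- makes it zero.
    have h1 : (fixedVectors π (fixingSubgroup (X ≃[L] X) (B : Set X))).starProjection (ξ : H) ∈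
        fixedVectors π (fixingSubgroup (X ≃[L] X) (A : Set X)) :=
      starProjection_mem_fixedVectors π _ _
        (mem_fixedVectors_of_finite_orbit hcat hhom hwei hπ A hA)
        (mem_fixedVectors_of_finite_orbit hcat hhom hwei hπ B hB) ξ ξ.2
        (finite_inner_of_fixed hcat hhom π A ξ ξ.2) fun g => ⟨g, rfl⟩
    have h2 := mem_fixedVectors_inf hcat hhom hwei hA hB h1
      (Submodule.starProjection_apply_mem _ _)
    have h3 : (fixedVectors π (fixingSubgroup (X ≃[L] X) (B : Set X))).starProjection (ξ : H) =
        0 := by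
      by_contra h0
      have hfin : Finite (A ⊓ B : L.Substructure X) :=
        ((Set.toFinite (A : Set X)).subset (inf_le_left : A ⊓ B ≤ A)).to_subtype
      have h4 := hmin' (A ⊓ B) ⟨hfin, hA.inf hB, (Submodule.ne_bot_iff _).2 ⟨_, h2, h0⟩⟩
      have h5 : ((A ⊓ B : L.Substructure X) : Set X) = A :=
        Set.eq_of_subset_of_ncard_le (inf_le_left : A ⊓ B ≤ A) h4 (Set.toFinite (A : Set X))
      have h6 : (A : Set X) ⊆ (g : X → X) '' (A : Set X) := by
        rw [← h5]
        exact fun x hx => by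
          rw [h5]
          exact hx.2
      refine hg (Set.eq_of_subset_of_ncard_le h6 ?_ ((Set.toFinite (A : Set X)).image _)).symm
      rw [Set.ncard_image_of_injective _ g.injective]
    have h7 := map_mem_fixedVectors_map g η.2
    rw [← Submodule.starProjection_eq_self_iff.2 h7,
      ← Submodule.inner_starProjection_left_eq_right, h3, inner_zero_left]
  have hequiv : UnitarilyEquivalent π (indAut A σ) :=
    equivalent_ind hirr (Submodule.subtypeₗᵢ _) hσ horth
  exact ⟨(hirr.of_equivalent hequiv).of_ind.of_comp, hequiv⟩

end Classification

/-! ### Equivalences between induced representations. -/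

section Uniqueness

variable {L : FirstOrder.Language.{u, v}} {X : Type w} [L.Structure X]

theorem autCongr_apply {A B : Type*} [L.Structure A] [L.Structure B] (f : A ≃[L] B)
    (g : A ≃[L] A) (b : B) : autCongr f g b = f (g (f.symm b)) := rfl

/-- If `x` maps `A` onto `B` as `f` does, then conjugation by `x` restricts to conjugation
by `f`. -/
theorem restrictHom_conj {A B : L.Substructure X} (f : A ≃[L] B) (x : X ≃[L] X)
    (hx : ∀ a : A, x a = f a) (k : setStabilizer B) :
    ∃ hk : x⁻¹ * k * x ∈ setStabilizer A,
      restrictHom B k = autCongr f (restrictHom A ⟨x⁻¹ * k * x, hk⟩) := by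
  have hxA : (x : X → X) '' (A : Set X) = B := image_eq_of_equiv f x hx
  have hk : x⁻¹ * k * x ∈ setStabilizer A := by
    have h1 : ((x⁻¹ * k * x : X ≃[L] X) : X → X) = x.symm ∘ (k : X ≃[L] X) ∘ x := rfl
    rw [mem_setStabilizer, h1, Set.image_comp, Set.image_comp, hxA, mem_setStabilizer.1 k.2, ← hxA,
      ← Set.image_comp]
    have h2 : x.symm ∘ x = id := funext x.symm_apply_apply
    rw [h2, Set.image_id]
  refine ⟨hk, FirstOrder.Language.Equiv.ext fun b => Subtype.ext ?_⟩
  obtain ⟨a, rfl⟩ := f.surjective b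
  rw [autCongr_apply, f.symm_apply_apply, restrictHom_apply, ← hx, ← hx, restrictHom_apply]
  change k.1 (x a) = x (x.symm (k.1 (x a)))
  rw [x.apply_symm_apply]

theorem equivalent_indAut_of_equiv (hhom : Homogeneous L X) {A B : L.Substructure X} [Finite A]
    [Finite B] (hA : AlgebraicallyClosed A) {K₁ K₂ : Type*}
    [NormedAddCommGroup K₁] [InnerProductSpace ℂ K₁] [CompleteSpace K₁]
    [NormedAddCommGroup K₂] [InnerProductSpace ℂ K₂] [CompleteSpace K₂]
    {σ : UnitaryRep (A ≃[L] A) K₁} {τ : UnitaryRep (B ≃[L] B) K₂}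
    (hσ : IsIrreducibleRep σ) (hτ : IsIrreducibleRep τ) (f : A ≃[L] B)
    (h : UnitarilyEquivalent σ (τ.comp (autCongr f).toMonoidHom)) :
    UnitarilyEquivalent (indAut A σ) (indAut B τ) := by
  obtain ⟨U, hU⟩ := h
  obtain ⟨x, hx⟩ := hhom A B inferInstance inferInstance f
  have := hτ.1
  -- The copy of `τ` inside the representation induced from `A`: the functions supported on the
  -- coset of `x`, where `x` extends `f`. This coset is stabilized by `G_B` because `x A = B`.
  let j : K₂ →ₗᵢ[ℂ] IndSpace (setStabilizer A) (σ.comp (restrictHom A)) :=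
    ((indAut A σ x).toLinearIsometry.comp
      (indDeltaIsometry (setStabilizer A) (σ.comp (restrictHom A)))).comp
        U.symm.toLinearIsometry
  have hj : ∀ v, j v = indAut A σ x (indDelta _ _ (U.symm v)) := fun _ => rfl
  refine equivalent_ind (isIrreducibleRep_indAut hhom A hA σ hσ) j (fun k v => ?_)
    fun g hg v w => ?_
  · obtain ⟨hk, hres⟩ := restrictHom_conj f x hx k
    have h1 : U.symm ((τ.comp (restrictHom B)) k v) =
        (σ.comp (restrictHom A)) ⟨x⁻¹ * k * x, hk⟩ (U.symm v) := by
      rw [U.symm_apply_eq, MonoidHom.comp_apply, MonoidHom.comp_apply, hU, U.apply_symm_apply, hres]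
      rfl
    rw [hj, hj, h1, ← ind_indDelta, ← rep_mul_apply, ← rep_mul_apply]
    congr 2
    simp [mul_assoc]
  · rw [hj, hj, inner_ind_indDelta, ← rep_mul_apply, ind_apply, indDelta_apply_of_notMem,
      inner_zero_right]
    intro hS
    refine hg ?_
    have h2 : x⁻¹ * g * x ∈ setStabilizer A := by
      have := inv_mem hS
      simpa [mul_assoc] using this
    have hxA : (x : X → X) '' (A : Set X) = B := image_eq_of_equiv f x hx
    have h3 : ((g : X ≃[L] X) : X → X) ∘ x = x ∘ (x⁻¹ * g * x : X ≃[L] X) := by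
      funext y
      change g (x y) = x (x.symm (g (x y)))
      rw [x.apply_symm_apply]
    rw [mem_setStabilizer, ← hxA, ← Set.image_comp, h3, Set.image_comp, mem_setStabilizer.1 h2]

/-- The image of `indDelta` at a nonzero vector is a nonzero function fixed by the fixer of `A`, so
it is supported on cosets with finite orbits. -/
theorem exists_translate_subset {A B : L.Substructure X} [Finite B]
    (hA : AlgebraicallyClosed A) {K₁ K₂ : Type*}
    [NormedAddCommGroup K₁] [InnerProductSpace ℂ K₁]
    [NormedAddCommGroup K₂] [InnerProductSpace ℂ K₂]
    {σ : UnitaryRep (A ≃[L] A) K₁} {τ : UnitaryRep (B ≃[L] B) K₂} [Nontrivial K₁]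
    (h : UnitarilyEquivalent (indAut A σ) (indAut B τ)) :
    ∃ x : X ≃[L] X, ∀ b ∈ B, x b ∈ A := by
  obtain ⟨Ψ, hΨ⟩ := h
  obtain ⟨v, hv⟩ := exists_ne (0 : K₁)
  have hfix : Ψ (indDelta _ _ v) ∈
      fixedVectors (indAut B τ) (fixingSubgroup (X ≃[L] X) (A : Set X)) := fun g hg => by
    rw [← hΨ, indDelta_mem_fixedVectors (fixingSubgroup_le_ker A σ) v g hg]
  have hne : ∃ x, (Ψ (indDelta _ _ v)) x ≠ 0 := by
    by_contra! h0
    have h1 : Ψ (indDelta _ _ v) = 0 := IndSpace.ext h0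
    have h2 := norm_indDelta (S := setStabilizer A) (σ := σ.comp (restrictHom A)) v
    rw [← Ψ.norm_map, h1, norm_zero] at h2
    exact hv (norm_eq_zero.1 h2.symm)
  obtain ⟨x, hx⟩ := hne
  exact ⟨x, apply_mem_of_finite_orbit hA (finite_orbit_of_apply_ne_zero hfix hx)⟩

theorem UnitarilyEquivalent.symm {G : Type*} [Group G] {H₁ H₂ : Type*}
    [NormedAddCommGroup H₁] [InnerProductSpace ℂ H₁]
    [NormedAddCommGroup H₂] [InnerProductSpace ℂ H₂]
    {π₁ : UnitaryRep G H₁} {π₂ : UnitaryRep G H₂} (h : UnitarilyEquivalent π₁ π₂) :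
    UnitarilyEquivalent π₂ π₁ := by
  obtain ⟨U, hU⟩ := h
  refine ⟨U.symm, fun g ξ => ?_⟩
  rw [U.symm_apply_eq, hU, U.apply_symm_apply]

theorem exists_equiv_of_equivalent_indAut (hhom : Homogeneous L X) {A B : L.Substructure X}
    [Finite A] [Finite B] (hA : AlgebraicallyClosed A) (hB : AlgebraicallyClosed B)
    {K₁ K₂ : Type*}
    [NormedAddCommGroup K₁] [InnerProductSpace ℂ K₁]
    [NormedAddCommGroup K₂] [InnerProductSpace ℂ K₂]
    {σ : UnitaryRep (A ≃[L] A) K₁} {τ : UnitaryRep (B ≃[L] B) K₂}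
    [Nontrivial K₁] [Nontrivial K₂] (h : UnitarilyEquivalent (indAut A σ) (indAut B τ)) :
    ∃ f : A ≃[L] B, UnitarilyEquivalent σ (τ.comp (autCongr f).toMonoidHom) := by
  obtain ⟨x, hx⟩ := exists_translate_subset hA h
  obtain ⟨y, hy⟩ := exists_translate_subset hB h.symm
  -- Each substructure embeds in the other by an automorphism of `X`, so the sizes agree and `x B =
  -- A`.
  have hcard : Nat.card A ≤ Nat.card B := card_le_of_forall_mem hy
  have hxB : (x : X → X) '' (B : Set X) = A := image_eq_of_forall_mem hx hcard
  have hxA : ∀ a ∈ A, x.symm a ∈ B := fun a ha => by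
    have : a ∈ (x : X → X) '' (B : Set X) := hxB ▸ ha
    obtain ⟨b, hb, rfl⟩ := this
    rwa [x.symm_apply_apply]
  let f : A ≃[L] B :=
    { toFun := fun a => ⟨x.symm a, hxA a a.2⟩
      invFun := fun b => ⟨x b, hx b b.2⟩
      left_inv := fun a => Subtype.ext (x.apply_symm_apply a)
      right_inv := fun b => Subtype.ext (x.symm_apply_apply b)
      map_fun' := fun F z => Subtype.ext (x.symm.map_fun F fun i => (z i : X))
      map_rel' := fun R z => x.symm.map_rel R fun i => (z i : X) }
  have hf : ∀ a : A, x⁻¹ a = f a := fun _ => rfl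
  refine ⟨f, ?_⟩
  obtain ⟨Ψ, hΨ⟩ := h
  have hfix : ∀ v, Ψ (indDelta _ _ v) ∈
      fixedVectors (indAut B τ) (fixingSubgroup (X ≃[L] X) (A : Set X)) := fun v g hg => by
    rw [← hΨ, indDelta_mem_fixedVectors (fixingSubgroup_le_ker A σ) v g hg]
  -- Any coset `y G_B` in the support also satisfies `y B = A = x B`, so it is the coset of `x`.
  -- Evaluation at `x` then loses nothing and is an isometry from `K₁` to `K₂`.
  have hsupp : ∀ v, Ψ (indDelta _ _ v) =
      indAut B τ x (indDelta _ _ ((Ψ (indDelta _ _ v)) x)) := fun v => by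
    refine eq_ind_indDelta _ x fun y hy => ?_
    have h1 := apply_mem_of_finite_orbit hA (finite_orbit_of_apply_ne_zero (hfix v) hy)
    have h2 : (y : X → X) '' (B : Set X) = A := image_eq_of_forall_mem h1 hcard
    have h3 : ((x⁻¹ * y : X ≃[L] X) : X → X) = x.symm ∘ y := rfl
    rw [mem_setStabilizer, h3, Set.image_comp, h2, ← hxB, ← Set.image_comp]
    have h4 : x.symm ∘ x = id := funext x.symm_apply_apply
    rw [h4, Set.image_id]
  let V : K₁ →ₗᵢ[ℂ] K₂ :=
    { toFun := fun v => (Ψ (indDeltaIsometry _ _ v)) x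
      map_add' := fun v w => by rw [map_add, map_add, IndSpace.add_apply]
      map_smul' := fun c v => by rw [map_smul, map_smul, IndSpace.smul_apply, RingHom.id_apply]
      norm_map' := fun v => by
        change ‖(Ψ (indDelta _ _ v)) x‖ = ‖v‖
        rw [← norm_indDelta (S := setStabilizer B) (σ := τ.comp (restrictHom B)),
          ← (indAut B τ x).norm_map, ← hsupp, Ψ.norm_map, norm_indDelta] }
  have hV : ∀ v, V v = (Ψ (indDelta _ _ v)) x := fun _ => rfl
  -- Functions supported on the coset of `x` are fixed by the fixer of `A`; their preimages under
  -- `Ψ` are too, and so are supported on the identity coset.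
  have hsurj : Function.Surjective V := fun w => by
    have hfixw : Ψ.symm (indAut B τ x (indDelta _ _ w)) ∈
        fixedVectors (indAut A σ) (fixingSubgroup (X ≃[L] X) (A : Set X)) := fun g hg => by
      apply Ψ.injective
      rw [hΨ, Ψ.apply_symm_apply, ← rep_mul_apply,
        ← mul_inv_cancel_left x (g * x), rep_mul_apply]
      congr 1
      refine indDelta_mem_fixedVectors (fixingSubgroup_le_ker B τ) w _ ?_
      rw [mem_fixingSubgroup_iff] at hg ⊢
      intro b hb
      rw [mul_smul, inv_smul_eq_iff, mul_smul]
      exact hg _ (hx b hb)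
    have h1 := eq_indDelta_of_fixed (not_finite_orbit hA) hfixw
    refine ⟨(Ψ.symm (indAut B τ x (indDelta _ _ w))) 1, ?_⟩
    rw [hV, ← h1, Ψ.apply_symm_apply, ind_apply, inv_mul_cancel, indDelta_apply_one]
  refine ⟨LinearIsometryEquiv.ofSurjective V hsurj, fun g v => ?_⟩
  change V (σ g v) = τ (autCongr f g) (V v)
  obtain ⟨k, rfl⟩ := restrictHom_surjective hhom A g
  have hk' : x⁻¹ * (k : X ≃[L] X) * x ∈ setStabilizer B := by
    have h3 : ((x⁻¹ * (k : X ≃[L] X) * x : X ≃[L] X) : X → X) = x.symm ∘ (k : X ≃[L] X) ∘ x := rfl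
    rw [mem_setStabilizer, h3, Set.image_comp, Set.image_comp, hxB, mem_setStabilizer.1 k.2,
      ← hxB, ← Set.image_comp]
    have h4 : x.symm ∘ x = id := funext x.symm_apply_apply
    rw [h4, Set.image_id]
  obtain ⟨hk, hres⟩ := restrictHom_conj f x⁻¹ hf ⟨_, hk'⟩
  have hkk : (⟨x⁻¹⁻¹ * (x⁻¹ * (k : X ≃[L] X) * x) * x⁻¹, hk⟩ : setStabilizer A) = k :=
    Subtype.ext (by simp [mul_assoc])
  have h5 : indDelta _ _ (σ (restrictHom A k) v) = indAut A σ k (indDelta _ _ v) :=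
    (ind_indDelta (σ := σ.comp (restrictHom A)) k v).symm
  rw [hV, h5, hΨ, ind_apply]
  have h6 : (k : X ≃[L] X)⁻¹ * x = x * ((⟨_, hk'⟩⁻¹ : setStabilizer B) : X ≃[L] X) := by
    simp [mul_assoc]
  rw [h6, (Ψ (indDelta _ _ v)).2.1, inv_inv, MonoidHom.comp_apply, hres]
  exact congrArg (fun k' => τ (autCongr f (restrictHom A k')) (V v)) hkk

end Uniqueness

end OmegaCat

theorem corollaryc (L : FirstOrder.Language.{u, v}) [Countable L.Symbols]
    (X : Type w) [L.Structure X] (hcat : OmegaCategorical L X) (hhom : Homogeneous L X)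
    (hwei : WeakElimination L X) :
    -- every member of the list is an irreducible (strongly continuous) unitary representation
    (∀ A : L.Substructure X, Finite A → AlgebraicallyClosed A →
      ∀ (K : Type h) [NormedAddCommGroup K] [InnerProductSpace ℂ K] [CompleteSpace K]
        (σ : UnitaryRep (A ≃[L] A) K), IsIrreducibleRep σ →
        StronglyContinuous (indAut A σ) ∧ IsIrreducibleRep (indAut A σ)) ∧
    -- every irreducible representation of `Aut(X)` is on the list
    (∀ (H : Type h) [NormedAddCommGroup H] [InnerProductSpace ℂ H] [CompleteSpace H]
      (π : UnitaryRep (X ≃[L] X) H), StronglyContinuous π → IsIrreducibleRep π →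
      ∃ A : L.Substructure X, Finite A ∧ AlgebraicallyClosed A ∧
        ∃ (K : Type h) (_ : NormedAddCommGroup K) (_ : InnerProductSpace ℂ K)
          (_ : CompleteSpace K) (σ : UnitaryRep (A ≃[L] A) K),
          IsIrreducibleRep σ ∧ UnitarilyEquivalent π (indAut A σ)) ∧
    -- two members coincide exactly when an isomorphism of the substructures matches them
    (∀ A B : L.Substructure X, Finite A → AlgebraicallyClosed A →
      Finite B → AlgebraicallyClosed B →
      ∀ (K₁ : Type h) [NormedAddCommGroup K₁] [InnerProductSpace ℂ K₁] [CompleteSpace K₁]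
        (K₂ : Type h) [NormedAddCommGroup K₂] [InnerProductSpace ℂ K₂] [CompleteSpace K₂]
        (σ : UnitaryRep (A ≃[L] A) K₁) (τ : UnitaryRep (B ≃[L] B) K₂),
        IsIrreducibleRep σ → IsIrreducibleRep τ →
        (UnitarilyEquivalent (indAut A σ) (indAut B τ) ↔
          ∃ f : A ≃[L] B, UnitarilyEquivalent σ (τ.comp (autCongr f).toMonoidHom))) ∧
    -- in particular, for a fixed substructure inequivalent representations stay inequivalent
    (∀ A : L.Substructure X, Finite A → AlgebraicallyClosed A →
      ∀ (K₁ : Type h) [NormedAddCommGroup K₁] [InnerProductSpace ℂ K₁] [CompleteSpace K₁]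
        (K₂ : Type h) [NormedAddCommGroup K₂] [InnerProductSpace ℂ K₂] [CompleteSpace K₂]
        (σ : UnitaryRep (A ≃[L] A) K₁) (τ : UnitaryRep (A ≃[L] A) K₂),
        IsIrreducibleRep σ → IsIrreducibleRep τ →
        (UnitarilyEquivalent (indAut A σ) (indAut A τ) ↔ UnitarilyEquivalent σ τ)) := by
  refine ⟨?_, ?_, ?_, ?_⟩
  · intro A _ hA K _ _ _ σ hσ
    exact ⟨stronglyContinuous_indAut A σ, isIrreducibleRep_indAut hhom A hA σ hσ⟩
  · intro H _ _ _ π hπ hirr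
    obtain ⟨A, hAf, hA, σ, hσ, hequiv⟩ := exists_equivalent_indAut hcat hhom hwei π hπ hirr
    exact ⟨A, hAf, hA, _, _, _, inferInstance, σ, hσ, hequiv⟩
  · intro A B _ hA _ hB K₁ _ _ _ K₂ _ _ _ σ τ hσ hτ
    have := hσ.1
    have := hτ.1
    exact ⟨exists_equiv_of_equivalent_indAut hhom hA hB,
      fun ⟨f, hf⟩ => equivalent_indAut_of_equiv hhom hA hσ hτ f hf⟩
  · intro A _ hA K₁ _ _ _ K₂ _ _ _ σ τ hσ hτ
    have := hσ.1
    have := hτ.1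
    constructor
    · intro h
      obtain ⟨f, U, hU⟩ := exists_equiv_of_equivalent_indAut hhom hA hA h
      -- Here `f` is an automorphism of `A`, so the twist of `τ` by `f` is inner and `τ f⁻¹` undoes
      -- it.
      refine ⟨U.trans (τ f⁻¹), fun g ξ => ?_⟩
      change τ f⁻¹ (U (σ g ξ)) = τ g (τ f⁻¹ (U ξ))
      rw [hU, ← rep_mul_apply]
      change τ f⁻¹ (τ (f * g * f⁻¹) (U ξ)) = _
      rw [← rep_mul_apply]
      congr 2
      group
    · intro h
      exact equivalent_indAut_of_equiv hhom hA hσ hτ (FirstOrder.Language.Equiv.refl L A) h
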